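/- Let $(R,\mathfrak m,k)$ be a commutative noetherian local ring with $\mathfrak m$-adic completion $\widehat R$, let $E=E_R(k)$ be an injective hull of the residue field $k$, and write $(-)^\vee=\operatorname{Hom}_R(-,E)$. Every $\mathfrak m$-torsion $R$-module $L$ (in particular $E$, and every artinian $R$-module) is an $\widehat R$-module via $rx=r_0x$, where $\mathfrak m^nx=0$ and $r_0\in R$ has the same image as $r\in\widehat R$ in $R/\mathfrak m^n$; hence $L^\vee$ is an $\widehat R$-module for every $R$-module $L$ (through $E$), and $\operatorname{Ext}^i_R(A,L)$ is an $\widehat R$-module for every artinian $R$-module $A$ and every $R$-module $L$ (through $A$). An $R$-module $M$ is mini-max if it has a noetherian submodule $N$ such that $M/N$ is artinian. Let $A$ be an artinian $R$-module. If $M$ is a mini-max $R$-module, then for every $i\ge 0$ there is an isomorphism of $\widehat R$-modules $$\operatorname{Ext}^i_R(A,M)\cong\operatorname{Ext}^i_{\widehat R}(M^\vee,A^\vee).$$ In particular, if $A'$ is an artinian $R$-module, then $A^\vee$ and $A'^\vee$ are noetherian $\widehat R$-modules, and $\operatorname{Ext}^i_R(A,A')\cong\operatorname{Ext}^i_{\widehat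 R}(A'^\vee,A^\vee)$ as $\widehat R$-modules for every $i\ge 0$. -/

import Mathlib

open CategoryTheory IsLocalRing

universe u

namespace MatlisDuality

/-- `M` is mini-max: it has a noetherian submodule `N` such that `M / N` is artinian. -/
def IsMiniMax (R : Type*) [CommRing R] (M : Type*) [AddCommGroup M] [Module R M] : Prop :=
  ∃ N : Submodule R M, IsNoetherian R N ∧ IsArtinian R (M ⧸ N)

/-- `ι : K → E` is an injective hull of `K`: a monomorphism into an injective module whose
image is an essential submodule. -/
structure IsInjectiveHull {R : Type*} [CommRing R] {K E : Type*} [AddCommGroup K] [Module R K]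
    [AddCommGroup E] [Module R E] (ι : K →ₗ[R] E) : Prop where
  injective : Function.Injective ι
  injective_module : Module.Injective R E
  essential : ∀ N : Submodule R E, N ⊓ LinearMap.range ι = ⊥ → N = ⊥

/-- Every module has an injective hull. -/
theorem exists_isInjectiveHull (R : Type u) [CommRing R] (K : Type u) [AddCommGroup K]
    [Module R K] : ∃ (E : Type u) (_ : AddCommGroup E) (_ : Module R E) (ι : K →ₗ[R] E),
      IsInjectiveHull ι := by
  -- an injective module containing `K`
  obtain ⟨I, _, _, hI, j, hj⟩ : ∃ (I : Type u) (_ : AddCommGroup I) (_ : Module R I)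
      (_ : Module.Injective R I) (j : K →ₗ[R] I), Function.Injective j := by
    let J : ModuleCat.{u} R := Injective.under (ModuleCat.of R K)
    have hJ : Injective J := inferInstanceAs (Injective (Injective.under (ModuleCat.of R K)))
    exact ⟨J, inferInstance, inferInstance, Module.injective_module_of_injective_object R J,
      (Injective.ι (ModuleCat.of R K)).hom, (ModuleCat.mono_iff_injective _).1 inferInstance⟩
  -- a maximal essential extension `P` of the image of `K` inside it
  let S : Set (Submodule R I) :=
    {P | LinearMap.range j ≤ P ∧ ∀ N ≤ P, N ⊓ LinearMap.range j = ⊥ → N = ⊥}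
  obtain ⟨P, -, hP⟩ := zorn_le_nonempty₀ S (by
    intro c hc hchain y hy
    refine ⟨sSup c, ⟨(hc hy).1.trans (le_sSup hy), fun N hN h => ?_⟩, fun z hz => le_sSup hz⟩
    rw [Submodule.eq_bot_iff]
    intro x hx
    obtain ⟨Q, hQ, hxQ⟩ := (Submodule.mem_sSup_of_directed ⟨y, hy⟩ hchain.directedOn).1 (hN hx)
    have h1 : N ⊓ Q = ⊥ := (hc hQ).2 _ inf_le_right (by
      rw [eq_bot_iff, ← h]
      exact inf_le_inf_right _ inf_le_left)
    exact (Submodule.mem_bot R).1 (h1 ▸ ⟨hx, hxQ⟩)) (LinearMap.range j)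
    ⟨le_rfl, fun N hN h => by rwa [inf_eq_left.2 hN] at h⟩
  have hjP := hP.prop.1
  -- `C` is maximal among the submodules meeting `P` trivially
  obtain ⟨C, -, hC⟩ := zorn_le_nonempty₀ {C : Submodule R I | C ⊓ P = ⊥} (by
    intro c hc hchain y hy
    refine ⟨sSup c, ?_, fun z hz => le_sSup hz⟩
    change sSup c ⊓ P = ⊥
    rw [Submodule.eq_bot_iff]
    rintro x ⟨hx, hxP⟩
    obtain ⟨Q, hQ, hxQ⟩ := (Submodule.mem_sSup_of_directed ⟨y, hy⟩ hchain.directedOn).1 hx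
    exact (Submodule.mem_bot R).1 ((hc hQ : Q ⊓ P = ⊥) ▸ ⟨hxQ, hxP⟩)) ⊥
    (bot_inf_eq P)
  have hCP : C ⊓ P = ⊥ := hC.prop
  let q : P →ₗ[R] I ⧸ C := C.mkQ.comp P.subtype
  have hq : Function.Injective q := by
    rw [← LinearMap.ker_eq_bot, Submodule.eq_bot_iff]
    intro x hx
    have hxC : (x : I) ∈ C := by simpa [q] using hx
    exact Subtype.ext ((Submodule.mem_bot R).1 (hCP ▸ ⟨hxC, x.2⟩))
  obtain ⟨g, hg⟩ := hI.out q hq P.subtype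
  -- the image of `P` in `I ⧸ C` is essential
  have hess : ∀ N : Submodule R (I ⧸ C), N ⊓ LinearMap.range q = ⊥ → N = ⊥ := by
    intro N hN
    have h1 : C ≤ N.comap C.mkQ := fun x hx => by
      have : C.mkQ x = 0 := by simpa using hx
      simp only [Submodule.mem_comap, this, zero_mem]
    have h2 : N.comap C.mkQ ⊓ P = ⊥ := by
      rw [Submodule.eq_bot_iff]
      rintro x ⟨hx, hxP⟩
      have h3 : q ⟨x, hxP⟩ = 0 := (Submodule.mem_bot R).1 (hN ▸ ⟨hx, ⟨x, hxP⟩, rfl⟩)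
      exact congrArg Subtype.val (hq (h3.trans (map_zero q).symm))
    have h4 : N.comap C.mkQ ≤ C := hC.le_of_ge h2 h1
    rw [Submodule.eq_bot_iff]
    intro y hy
    obtain ⟨x, rfl⟩ := C.mkQ_surjective y
    simpa using h4 hy
  have hgq : Function.Injective g := by
    rw [← LinearMap.ker_eq_bot]
    refine hess _ ?_
    rw [Submodule.eq_bot_iff]
    rintro _ ⟨hx, p, rfl⟩
    have : (p : I) = 0 := (hg p).symm.trans hx
    rw [show p = 0 from Subtype.ext this, map_zero]
  -- by maximality of `P`, the image of `g` is `P`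
  have hPg : P ≤ LinearMap.range g := fun x hx => ⟨q ⟨x, hx⟩, hg ⟨x, hx⟩⟩
  have hgP : LinearMap.range g ≤ P := by
    refine hP.le_of_ge ⟨hjP.trans hPg, fun N hN h => ?_⟩ hPg
    have h1 : N ⊓ P = ⊥ := hP.prop.2 _ inf_le_right (by
      rw [eq_bot_iff, ← h]
      exact inf_le_inf_right _ inf_le_left)
    have h2 : N.comap g = ⊥ := hess _ (by
      rw [Submodule.eq_bot_iff]
      rintro _ ⟨hx, p, rfl⟩
      have h3 : (p : I) ∈ N ⊓ P := ⟨by simpa [hg p] using hx, p.2⟩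
      rw [h1, Submodule.mem_bot] at h3
      rw [show p = 0 from Subtype.ext h3, map_zero])
    rw [Submodule.eq_bot_iff]
    intro x hx
    obtain ⟨y, rfl⟩ := hN hx
    have h4 : y ∈ N.comap g := hx
    rw [h2, Submodule.mem_bot] at h4
    rw [h4, map_zero]
  -- so `P` is a retract of `I`
  let ρ : I →ₗ[R] P := (g.codRestrict P fun x => hgP ⟨x, rfl⟩).comp C.mkQ
  have hρ : ∀ p : P, ρ p = p := fun p => Subtype.ext (hg p)
  refine ⟨P, inferInstance, inferInstance, j.codRestrict P fun x => hjP ⟨x, rfl⟩, ?_, ⟨?_⟩, ?_⟩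
  · exact fun x y h => hj (congrArg Subtype.val h)
  · intro X Y _ _ _ _ f hf k
    obtain ⟨l, hl⟩ := hI.out f hf (P.subtype.comp k)
    exact ⟨ρ.comp l, fun x => by
      rw [LinearMap.comp_apply, hl]
      exact hρ (k x)⟩
  · intro N hN
    have h1 : N.map P.subtype = ⊥ := hP.prop.2 _ (Submodule.map_subtype_le P N) (by
      rw [Submodule.eq_bot_iff]
      rintro _ ⟨⟨n, hn, rfl⟩, k, hk⟩
      have h2 : n ∈ N ⊓ LinearMap.range (j.codRestrict P fun x => hjP ⟨x, rfl⟩) :=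
        ⟨hn, k, Subtype.ext hk⟩
      rw [hN, Submodule.mem_bot] at h2
      rw [h2, map_zero])
    exact Submodule.map_injective_of_injective P.injective_subtype
      (h1.trans (Submodule.map_bot _).symm)

section Torsion

variable {R : Type*} [CommRing R] [IsLocalRing R]
variable {L : Type*} [AddCommGroup L] [Module R L]

/-- `L` is `𝔪`-torsion, where `𝔪` is the maximal ideal of the local ring `R`. -/
def IsMaxTorsion (R : Type*) [CommRing R] [IsLocalRing R]
    (L : Type*) [AddCommGroup L] [Module R L] : Prop :=
  ∀ x : L, ∃ n : ℕ, ∀ a ∈ maximalIdeal R ^ n, a • x = 0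

lemma IsMaxTorsion.of_span
    (h : ∀ x : L, ∃ n : ℕ,
      maximalIdeal R ^ n • (⊤ : Submodule R (Submodule.span R {x})) = ⊥) :
    IsMaxTorsion R L := by
  intro x
  obtain ⟨n, hn⟩ := h x
  refine ⟨n, fun a ha => ?_⟩
  have hx : a • (⟨x, Submodule.mem_span_singleton_self x⟩ : Submodule.span R {x}) ∈
      maximalIdeal R ^ n • (⊤ : Submodule R (Submodule.span R {x})) :=
    Submodule.smul_mem_smul ha trivial
  rw [hn, Submodule.mem_bot] at hx
  exact congrArg Subtype.val hx

lemma isMaxTorsion_of_isArtinian [IsNoetherianRing R] [IsArtinian R L] : IsMaxTorsion R L := by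
  refine IsMaxTorsion.of_span fun x => ?_
  let f : ℕ →o (Submodule R (Submodule.span R {x}))ᵒᵈ :=
    ⟨fun n => OrderDual.toDual (maximalIdeal R ^ n • ⊤), fun a b hab =>
      OrderDual.toDual_le_toDual.2 (Submodule.smul_mono_left (Ideal.pow_le_pow_right hab))⟩
  obtain ⟨n, hn⟩ := IsArtinian.monotone_stabilizes f
  refine ⟨n, ?_⟩
  have h1 : maximalIdeal R ^ n • (⊤ : Submodule R (Submodule.span R {x})) =
      maximalIdeal R ^ (n + 1) • ⊤ := OrderDual.toDual.injective (hn (n + 1) (Nat.le_succ n))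
  refine Submodule.eq_bot_of_le_smul_of_le_jacobson_bot (maximalIdeal R) _
    (IsNoetherian.noetherian _) ?_ (IsLocalRing.maximalIdeal_le_jacobson ⊥)
  rw [← mul_smul, ← pow_succ', ← h1]

lemma IsInjectiveHull.isMaxTorsion [IsNoetherianRing R] {ι : ResidueField R →ₗ[R] L}
    (hι : IsInjectiveHull ι) : IsMaxTorsion R L := by
  refine IsMaxTorsion.of_span fun x => ?_
  by_contra! hx
  set N := Submodule.span R {x}
  have key : ∀ n : ℕ, ι 1 ∈ (maximalIdeal R ^ n • (⊤ : Submodule R N)).map N.subtype := by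
    intro n
    have h1 : (maximalIdeal R ^ n • (⊤ : Submodule R N)).map N.subtype ≠ ⊥ := by
      intro h
      refine hx n (Submodule.map_injective_of_injective N.injective_subtype ?_)
      rw [h, Submodule.map_bot]
    have h2 := mt (hι.essential _) h1
    obtain ⟨y, ⟨hy1, z, hz⟩, hy0⟩ := Submodule.exists_mem_ne_zero_of_ne_bot h2
    have hz0 : z ≠ 0 := by
      rintro rfl
      exact hy0 (by rw [← hz, map_zero])
    obtain ⟨r, hr⟩ := IsLocalRing.residue_surjective (R := R) z⁻¹
    have h3 : r • z = 1 := by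
      rw [Algebra.smul_def]
      change IsLocalRing.residue R r * z = 1
      rw [hr, inv_mul_cancel₀ hz0]
    rw [← h3, map_smul, hz]
    exact Submodule.smul_mem _ r hy1
  obtain ⟨y, -, hy⟩ := key 0
  have hy' : y = 0 := by
    refine IsHausdorff.haus (I := maximalIdeal R) inferInstance y fun n => ?_
    rw [SModEq.zero]
    obtain ⟨w, hw, hwy⟩ := key n
    rwa [← show w = y from N.injective_subtype (hwy.trans hy.symm)]
  rw [hy', map_zero] at hy
  exact one_ne_zero (hι.injective ((map_zero ι).trans hy).symm)

/-- For `r` in the completion and `x` in an `𝔪`-torsion module, `r x := r₀ x`, where `𝔪ⁿ x = 0` and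
`r₀ ∈ R` has the same class as `r` modulo `𝔪ⁿ`. -/
noncomputable def completionSMul (h : IsMaxTorsion R L)
    (r : AdicCompletion (maximalIdeal R) R) (x : L) : L :=
  (Ideal.Quotient.mk_surjective
    (AdicCompletion.evalₐ (maximalIdeal R) (h x).choose r)).choose • x

/-- The value of `completionSMul` does not depend on the choices. -/
lemma completionSMul_eq (h : IsMaxTorsion R L) (r : AdicCompletion (maximalIdeal R) R) (x : L)
    (n : ℕ) (hn : ∀ a ∈ maximalIdeal R ^ n, a • x = 0) (r₀ : R)
    (hr : AdicCompletion.evalₐ (maximalIdeal R) n r = Ideal.Quotient.mk _ r₀) :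
    completionSMul h r x = r₀ • x := by
  have aux : ∀ (m n : ℕ) (a b : R), m ≤ n → (∀ c ∈ maximalIdeal R ^ m, c • x = 0) →
      AdicCompletion.evalₐ (maximalIdeal R) m r = Ideal.Quotient.mk _ a →
      AdicCompletion.evalₐ (maximalIdeal R) n r = Ideal.Quotient.mk _ b → a • x = b • x := by
    intro m n a b hmn hm ha hb
    obtain ⟨f, rfl⟩ := AdicCompletion.mk_surjective (maximalIdeal R) R r
    rw [AdicCompletion.evalₐ_mk] at ha hb
    have h1 := Ideal.Quotient.eq.1 ha
    have h2 := Ideal.pow_le_pow_right hmn (Ideal.Quotient.eq.1 hb)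
    have h0 := Ideal.Quotient.eq.1 (AdicCompletion.Ideal.mk_eq_mk (maximalIdeal R) hmn f)
    have h3 : a - b ∈ maximalIdeal R ^ m := by
      have h5 := sub_mem (sub_mem h2 h1) h0
      convert h5 using 1
      simp only [AdicCompletion.AdicCauchySequence] at *
      ring
    have h4 := hm _ h3
    rwa [sub_smul, sub_eq_zero] at h4
  have hm := (h x).choose_spec
  have hr' := (Ideal.Quotient.mk_surjective
    (AdicCompletion.evalₐ (maximalIdeal R) (h x).choose r)).choose_spec
  rcases le_total (h x).choose n with hle | hle
  · exact aux _ _ _ _ hle hm hr'.symm hr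
  · exact (aux _ _ _ _ hle hn hr hr'.symm).symm

/-- The action of the completion on an `𝔪`-torsion module, by `R`-linear endomorphisms. -/
noncomputable def completionAction (h : IsMaxTorsion R L) :
    AdicCompletion (maximalIdeal R) R →+* Module.End R L :=
  have ev (n : ℕ) (r : AdicCompletion (maximalIdeal R) R) :
      ∃ r₀, AdicCompletion.evalₐ (maximalIdeal R) n r = Ideal.Quotient.mk _ r₀ := by
    obtain ⟨r₀, h₀⟩ := Ideal.Quotient.mk_surjective (AdicCompletion.evalₐ (maximalIdeal R) n r)
    exact ⟨r₀, h₀.symm⟩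
  { toFun r :=
      { toFun := completionSMul h r
        map_add' := by
          intro x y
          obtain ⟨m, hm⟩ := h x
          obtain ⟨n, hn⟩ := h y
          have hm' : ∀ a ∈ maximalIdeal R ^ (m + n), a • x = 0 := fun a ha =>
            hm a (Ideal.pow_le_pow_right (Nat.le_add_right m n) ha)
          have hn' : ∀ a ∈ maximalIdeal R ^ (m + n), a • y = 0 := fun a ha =>
            hn a (Ideal.pow_le_pow_right (Nat.le_add_left n m) ha)
          obtain ⟨r₀, hr⟩ := ev (m + n) r
          rw [completionSMul_eq h r x _ hm' r₀ hr, completionSMul_eq h r y _ hn' r₀ hr,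
            completionSMul_eq h r (x + y) _
              (fun a ha => by rw [smul_add, hm' a ha, hn' a ha, add_zero]) r₀ hr, smul_add]
        map_smul' := by
          intro c x
          obtain ⟨m, hm⟩ := h x
          obtain ⟨r₀, hr⟩ := ev m r
          rw [completionSMul_eq h r x _ hm r₀ hr, completionSMul_eq h r (c • x) m
            (fun a ha => by rw [smul_comm, hm a ha, smul_zero]) r₀ hr, smul_comm]
          rfl }
    map_one' := by
      ext x
      obtain ⟨m, hm⟩ := h x
      exact (completionSMul_eq h 1 x m hm 1 (by rw [map_one, map_one])).trans (one_smul R x)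
    map_zero' := by
      ext x
      obtain ⟨m, hm⟩ := h x
      exact (completionSMul_eq h 0 x m hm 0 (by rw [map_zero, map_zero])).trans (zero_smul R x)
    map_add' := by
      intro r s
      ext x
      obtain ⟨m, hm⟩ := h x
      obtain ⟨r₀, hr⟩ := ev m r
      obtain ⟨s₀, hs⟩ := ev m s
      change completionSMul h (r + s) x = completionSMul h r x + completionSMul h s x
      rw [completionSMul_eq h r x m hm r₀ hr, completionSMul_eq h s x m hm s₀ hs,
        completionSMul_eq h (r + s) x m hm (r₀ + s₀) (by rw [map_add, hr, hs, map_add]), add_smul]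
    map_mul' := by
      intro r s
      ext x
      obtain ⟨m, hm⟩ := h x
      obtain ⟨r₀, hr⟩ := ev m r
      obtain ⟨s₀, hs⟩ := ev m s
      change completionSMul h (r * s) x = completionSMul h r (completionSMul h s x)
      rw [completionSMul_eq h s x m hm s₀ hs,
        completionSMul_eq h r (s₀ • x) m
          (fun a ha => by rw [smul_comm, hm a ha, smul_zero]) r₀ hr,
        completionSMul_eq h (r * s) x m hm (r₀ * s₀) (by rw [map_mul, hr, hs, map_mul]), mul_smul] }

end Torsion

section Dual

variable {R : Type u} [CommRing R] [IsLocalRing R]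

/-- `Hom_R(M, E)` as a module over the completion, which acts through the `𝔪`-torsion
module `E`: `(r f)(x) = r (f x)`. -/
noncomputable def matlisDual {E : Type u} [AddCommGroup E] [Module R E] (hE : IsMaxTorsion R E)
    (M : Type u) [AddCommGroup M] [Module R M] :
    ModuleCat.{u} (AdicCompletion (maximalIdeal R) R) :=
  letI : Module (AdicCompletion (maximalIdeal R) R) (M →ₗ[R] E) :=
    Module.compHom (M →ₗ[R] E) (completionAction hE)
  ModuleCat.of (AdicCompletion (maximalIdeal R) R) (M →ₗ[R] E)

/-- For an `𝔪`-torsion module `A`, the completion acts on `Ext_R^i(A, M)` through `A`, by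
functoriality of Ext in its first argument. -/
@[reducible]
noncomputable def extCompletionModule {A : Type u} [AddCommGroup A] [Module R A]
    (hA : IsMaxTorsion R A) (M : Type u) [AddCommGroup M] [Module R M] (i : ℕ) :
    Module (AdicCompletion (maximalIdeal R) R)
      (Abelian.Ext (ModuleCat.of R A) (ModuleCat.of R M) i) where
  smul r x := (Abelian.Ext.mk₀ (ModuleCat.ofHom (completionAction hA r))).comp x (zero_add i)
  one_smul x := by
    change (Abelian.Ext.mk₀ (ModuleCat.ofHom (completionAction hA 1))).comp x _ = x
    rw [map_one]
    exact Abelian.Ext.mk₀_id_comp x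
  mul_smul r s x := by
    change (Abelian.Ext.mk₀ (ModuleCat.ofHom (completionAction hA (r * s)))).comp x _ =
      (Abelian.Ext.mk₀ (ModuleCat.ofHom (completionAction hA r))).comp
        ((Abelian.Ext.mk₀ (ModuleCat.ofHom (completionAction hA s))).comp x (zero_add i))
        (zero_add i)
    rw [Abelian.Ext.mk₀_comp_mk₀_assoc, mul_comm r s, map_mul]
    rfl
  smul_zero r := Abelian.Ext.comp_zero _ _ _ _ _
  smul_add r x y := Abelian.Ext.comp_add _ _ _ _
  add_smul r s x := by
    change (Abelian.Ext.mk₀ (ModuleCat.ofHom (completionAction hA (r + s)))).comp x _ =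
      (Abelian.Ext.mk₀ (ModuleCat.ofHom (completionAction hA r))).comp x _ +
      (Abelian.Ext.mk₀ (ModuleCat.ofHom (completionAction hA s))).comp x _
    rw [← Abelian.Ext.add_comp, ← Abelian.Ext.mk₀_add, map_add]
    rfl
  zero_smul x := by
    change (Abelian.Ext.mk₀ (ModuleCat.ofHom (completionAction hA 0))).comp x _ = 0
    rw [map_zero]
    exact (congrArg (fun t => Abelian.Ext.comp t x (zero_add i)) (Abelian.Ext.mk₀_zero _ _)).trans
      (Abelian.Ext.zero_comp _ _ _ _ _)

end Dual

end MatlisDuality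

/-! Write `S` for the completion. The isomorphism is a composite of two. Swapping arguments gives
`Hom_R(A, Hom_S(X, E)) = Hom_S(X, Hom_R(A, E))`; since `E` is injective over both `R` and `S`, this
derives to `Ext_R^i(A, Hom_S(X, E)) ≅ Ext_S^i(X, A^∨)` (`exists_ext_swap`). For `X = M^∨` it remains
to compare `M` with its bidual `Hom_S(M^∨, E)`, that is, to show that `Ext_R(A, C(M)) = 0` in all
degrees, where `C(M)` is the cokernel of the injective evaluation map.

The functor `C` is exact (`IsInjectiveHull.bidualCoker_shortExact`) and vanishes on artinian
modules, so only noetherian `M` matter. There noetherian induction gives `Ext_R(k, C(M)) = 0`: a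
copy of `k` in `M` can be divided out because `C(k) = 0`. If there is none, some `x` in the maximal
ideal is regular on `M`; multiplication by `x` on `Ext_R(k, C(M))` is surjective, since `Ext_R(k,
C(M/xM)) = 0`, and zero, since `x` kills `k`. Dimension shifting along injective hulls passes from
`k` to any torsion module (`ExtVanishes.of_isMaxTorsion`).

The classical part of Matlis theory supplies the rest: `E` is artinian, its endomorphism ring is
`S`, duals of artinian modules are noetherian over `S`, and artinian modules are reflexive. Hence
`S`, which embeds in the dual of `E`, is noetherian, and Baer's criterion makes `E` injective over
`S`. -/

namespace MatlisDuality

/-! ### Socles and maps from the residue field. -/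

section Socle

variable {R : Type*} [CommRing R] [IsLocalRing R]
variable {L : Type*} [AddCommGroup L] [Module R L]

/-- An element killed by the maximal ideal defines a map from the residue field. -/
lemma exists_residueField_linearMap (y : L) (hy : ∀ a ∈ maximalIdeal R, a • y = 0) :
    ∃ f : ResidueField R →ₗ[R] L, f 1 = y := by
  refine ⟨(maximalIdeal R).liftQ (LinearMap.toSpanSingleton R L y) fun a ha => ?_, ?_⟩
  · simpa using hy a ha
  · exact ((maximalIdeal R).liftQ_apply _ (1 : R)).trans (by simp)

/-- A nonzero element killed by a power of the maximal ideal has a nonzero multiple in the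
socle. -/
lemma exists_smul_mem_socle (n : ℕ) (y : L) (hy : y ≠ 0)
    (hn : ∀ a ∈ maximalIdeal R ^ n, a • y = 0) :
    ∃ r : R, r • y ≠ 0 ∧ ∀ a ∈ maximalIdeal R, a • r • y = 0 := by
  induction n generalizing y with
  | zero => exact absurd (by simpa using hn 1 (by simp)) hy
  | succ n ih =>
    by_cases h : ∀ a ∈ maximalIdeal R ^ n, a • y = 0
    · exact ih y hy h
    · push Not at h
      obtain ⟨r, hr, hry⟩ := h
      refine ⟨r, hry, fun a ha => ?_⟩
      rw [← mul_smul]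
      exact hn _ (by rw [pow_succ']; exact Ideal.mul_mem_mul ha hr)

lemma residueField_smul_surjective (z : ResidueField R) : ∃ r : R, r • (1 : ResidueField R) = z := by
  obtain ⟨r, rfl⟩ := IsLocalRing.residue_surjective (R := R) z
  exact ⟨r, by rw [Algebra.smul_def, mul_one]; rfl⟩

lemma smul_residueField_eq_zero {a : R} (ha : a ∈ maximalIdeal R) (z : ResidueField R) :
    a • z = 0 := by
  rw [Algebra.smul_def]
  have : algebraMap R (ResidueField R) a = 0 := (residue_eq_zero_iff a).2 ha
  rw [this, zero_mul]

end Socle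

/-- Noetherian induction on the quotients of a module. -/
theorem noetherian_quotient_induction {R : Type u} [CommRing R]
    {P : ∀ (M : Type u) [AddCommGroup M] [Module R M], Prop}
    (step : ∀ (Q : Type u) [AddCommGroup Q] [Module R Q] [IsNoetherian R Q],
      (∀ L : Submodule R Q, L ≠ ⊥ → P (Q ⧸ L)) → P Q)
    (M : Type u) [AddCommGroup M] [Module R M] [IsNoetherian R M] : P M := by
  -- Ranging over all surjections with kernel `N`, rather than over `M ⧸ N` alone, avoids
  -- transporting `P` along isomorphisms.
  have key : ∀ (N : Submodule R M) (Q : Type u) [AddCommGroup Q] [Module R Q] (f : M →ₗ[R] Q),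
      Function.Surjective f → LinearMap.ker f = N → P Q := by
    intro N
    induction N using IsNoetherian.induction with
    | hgt N ih =>
    intro Q _ _ f hf hN
    have : IsNoetherian R Q := isNoetherian_of_surjective f (LinearMap.range_eq_top.2 hf)
    refine step Q fun L hL => ih (LinearMap.ker (L.mkQ.comp f)) ?_ _ (L.mkQ.comp f)
      (L.mkQ_surjective.comp hf) rfl
    rw [gt_iff_lt, ← hN]
    refine lt_of_le_of_ne (fun x hx => by simp [LinearMap.mem_ker.1 hx]) fun h => hL ?_
    rw [Submodule.eq_bot_iff]
    intro y hy
    obtain ⟨x, rfl⟩ := hf y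
    have : x ∈ LinearMap.ker (L.mkQ.comp f) := by simpa using hy
    rw [← h] at this
    exact this
  exact key ⊥ M LinearMap.id Function.surjective_id LinearMap.ker_id

/-! ### The injective hull of the residue field: cogenerator and socle. -/

section Hull

variable {R : Type u} [CommRing R] [IsLocalRing R]
variable {E : Type u} [AddCommGroup E] [Module R E] {ι : ResidueField R →ₗ[R] E}

/-- The injective hull of the residue field is a cogenerator. -/
lemma IsInjectiveHull.exists_apply_ne_zero (hι : IsInjectiveHull ι) {M : Type u} [AddCommGroup M]
    [Module R M] (x : M) (hx : x ≠ 0) : ∃ f : M →ₗ[R] E, f x ≠ 0 := by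
  -- The annihilator of `x ≠ 0` is proper, so the cyclic module on `x` maps onto `k` with `x ↦ 1`;
  -- follow this by `ι` and extend to `M` by injectivity.
  have hle : Ideal.torsionOf R M x ≤ maximalIdeal R := le_maximalIdeal fun h => hx <| by
    simpa using (Ideal.mem_torsionOf_iff x (1 : R)).1 (h ▸ trivial)
  let p : Submodule.span R {x} →ₗ[R] ResidueField R :=
    (Submodule.factor hle).comp
      (Ideal.quotTorsionOfEquivSpanSingleton R M x).symm.toLinearMap
  have hp : p ⟨x, Submodule.mem_span_singleton_self x⟩ = 1 := by
    have : (Ideal.quotTorsionOfEquivSpanSingleton R M x).symm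
        ⟨x, Submodule.mem_span_singleton_self x⟩ = Submodule.Quotient.mk 1 := by
      rw [LinearEquiv.symm_apply_eq, Ideal.quotTorsionOfEquivSpanSingleton_apply_mk]
      ext; simp
    exact congrArg (Submodule.factor hle) this
  obtain ⟨f, hf⟩ := hι.injective_module.out (Submodule.span R {x}).subtype
    (Submodule.injective_subtype _) (ι.comp p)
  refine ⟨f, fun h => one_ne_zero (α := ResidueField R) (hι.injective ?_)⟩
  rw [map_zero, ← h, ← hp]
  exact (hf ⟨x, Submodule.mem_span_singleton_self x⟩).symm

lemma IsInjectiveHull.exists_apply_ne_zero_of_notMem (hι : IsInjectiveHull ι) {M : Type u}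
    [AddCommGroup M] [Module R M] (N : Submodule R M) (x : M) (hx : x ∉ N) :
    ∃ f : M →ₗ[R] E, (∀ y ∈ N, f y = 0) ∧ f x ≠ 0 := by
  obtain ⟨f, hf⟩ := hι.exists_apply_ne_zero (N.mkQ x) (by simpa using hx)
  refine ⟨f.comp N.mkQ, fun y hy => ?_, hf⟩
  rw [LinearMap.comp_apply, Submodule.mkQ_apply, (Submodule.Quotient.mk_eq_zero N).2 hy, map_zero]

/-- The socle of the injective hull of the residue field is the residue field. -/
lemma IsInjectiveHull.mem_range_of_forall_smul_eq_zero (hι : IsInjectiveHull ι) (y : E)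
    (hy : ∀ a ∈ maximalIdeal R, a • y = 0) : ∃ z, ι z = y := by
  by_cases hy0 : y = 0
  · exact ⟨0, by rw [map_zero, hy0]⟩
  have h : Submodule.span R {y} ⊓ LinearMap.range ι ≠ ⊥ := fun h => hy0 <| by
    simpa using hι.essential _ h
  obtain ⟨w, ⟨hw, z, hz⟩, hw0⟩ := Submodule.exists_mem_ne_zero_of_ne_bot h
  obtain ⟨r, rfl⟩ := Submodule.mem_span_singleton.1 hw
  -- A nonunit `r` would kill `y`, but `r • y` is the nonzero element shared with the image of `ι`.
  have hr : IsUnit r := by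
    by_contra hr
    exact hw0 (hy r ((mem_maximalIdeal r).2 hr))
  obtain ⟨s, hs⟩ := hr.exists_left_inv
  exact ⟨s • z, by rw [map_smul, hz, ← mul_smul, hs, one_smul]⟩

end Hull

/-! ### Biduals and the evaluation map. -/

section Bidual

variable (R : Type u) [CommRing R] (S : Type u) [CommRing S] [Algebra R S]
variable (E : Type u) [AddCommGroup E] [Module R E] [Module S E] [IsScalarTower R S E]
variable (M : Type u) [AddCommGroup M] [Module R M]

/-- The evaluation map from a module to its bidual `Hom_S(Hom_R(M, E), E)`. -/
def bidualMap : M →ₗ[R] ((M →ₗ[R] E) →ₗ[S] E) where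
  toFun x :=
    { toFun f := f x
      map_add' _ _ := rfl
      map_smul' _ _ := rfl }
  map_add' x y := by ext f; exact map_add f x y
  map_smul' r x := by ext f; exact map_smul f r x

variable {R M}

@[simp]
lemma bidualMap_apply (x : M) (f : M →ₗ[R] E) : bidualMap R S E M x f = f x := rfl

variable {E}

lemma bidualMap_injective [IsLocalRing R] {ι : ResidueField R →ₗ[R] E} (hι : IsInjectiveHull ι) :
    Function.Injective (bidualMap R S E M) := by
  rw [← LinearMap.ker_eq_bot, Submodule.eq_bot_iff]
  intro x hx
  by_contra h
  obtain ⟨f, hf⟩ := hι.exists_apply_ne_zero x h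
  exact hf (LinearMap.congr_fun hx f)

/-- Maps `k → E` land in the socle, so `ι` generates the dual of `k` over `R`, and an element of the
bidual is determined by its value at `ι`, again a socle element. Nothing about `S` beyond the scalar
tower enters. -/
lemma bidualMap_residueField_surjective [IsLocalRing R] {ι : ResidueField R →ₗ[R] E}
    (hι : IsInjectiveHull ι) : Function.Surjective (bidualMap R S E (ResidueField R)) := by
  intro g
  obtain ⟨z, hz⟩ := hι.mem_range_of_forall_smul_eq_zero (g ι) fun a ha => by
    have : a • ι = 0 := by
      ext w
      rw [LinearMap.smul_apply, ← map_smul, smul_residueField_eq_zero ha, map_zero,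
        LinearMap.zero_apply]
    rw [← g.map_smul_of_tower, this, map_zero]
  refine ⟨z, ?_⟩
  ext φ
  obtain ⟨w, hw⟩ := hι.mem_range_of_forall_smul_eq_zero (φ 1) fun a ha => by
    rw [← map_smul, smul_residueField_eq_zero ha, map_zero]
  obtain ⟨r, rfl⟩ := residueField_smul_surjective w
  have hφ : φ = r • ι := by
    ext v
    obtain ⟨s, rfl⟩ := residueField_smul_surjective v
    rw [LinearMap.smul_apply, map_smul, map_smul, ← hw, map_smul, smul_comm]
  rw [hφ, g.map_smul_of_tower, ← hz, bidualMap_apply, LinearMap.smul_apply]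

variable {S}

variable {N P : Type u} [AddCommGroup N] [Module R N] [AddCommGroup P] [Module R P]

variable (R S E) in
/-- Functoriality of the bidual. -/
def bidualFunc (f : M →ₗ[R] N) : ((M →ₗ[R] E) →ₗ[S] E) →ₗ[R] ((N →ₗ[R] E) →ₗ[S] E) where
  toFun y :=
    { toFun φ := y (φ.comp f)
      map_add' φ ψ := by rw [LinearMap.add_comp, map_add]
      map_smul' s φ := by rw [LinearMap.smul_comp, map_smul]; rfl }
  map_add' _ _ := rfl
  map_smul' _ _ := rfl

@[simp]
lemma bidualFunc_apply (f : M →ₗ[R] N) (y : (M →ₗ[R] E) →ₗ[S] E) (φ : N →ₗ[R] E) :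
    bidualFunc R S E f y φ = y (φ.comp f) := rfl

lemma bidualFunc_bidualMap (f : M →ₗ[R] N) (x : M) :
    bidualFunc R S E f (bidualMap R S E M x) = bidualMap R S E N (f x) := rfl

lemma bidualFunc_injective [hR : Module.Injective R E] (f : M →ₗ[R] N) (hf : Function.Injective f) :
    Function.Injective (bidualFunc R S E f) := by
  rw [← LinearMap.ker_eq_bot, Submodule.eq_bot_iff]
  intro y hy
  ext φ
  obtain ⟨ψ, hψ⟩ := hR.out f hf φ
  rw [show φ = ψ.comp f from LinearMap.ext fun x => (hψ x).symm]
  exact LinearMap.congr_fun hy ψ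

variable [hS : Module.Injective S E]

lemma bidualFunc_surjective (f : M →ₗ[R] N) (hf : Function.Surjective f) :
    Function.Surjective (bidualFunc R S E f) := by
  intro y
  let d : (N →ₗ[R] E) →ₗ[S] (M →ₗ[R] E) :=
    { toFun φ := φ.comp f
      map_add' _ _ := rfl
      map_smul' _ _ := rfl }
  obtain ⟨z, hz⟩ := hS.out d (fun φ ψ h => by
    ext x
    obtain ⟨x, rfl⟩ := hf x
    exact LinearMap.congr_fun h x) y
  exact ⟨z, LinearMap.ext hz⟩

variable [hR : Module.Injective R E]

/-- The bidual composes `Hom_R(-, E)` with `Hom_S(-, E)`, each exact by injectivity of `E` over its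
own ring. -/
lemma bidualFunc_exact (f : M →ₗ[R] N) (g : N →ₗ[R] P)
    (hfg : Function.Exact f g) :
    Function.Exact (bidualFunc R S E f) (bidualFunc R S E g) := by
  intro y
  constructor
  · intro hy
    let d : (N →ₗ[R] E) →ₗ[S] (M →ₗ[R] E) :=
      { toFun φ := φ.comp f
        map_add' _ _ := rfl
        map_smul' _ _ := rfl }
    have hker : LinearMap.ker d ≤ LinearMap.ker y := by
      intro φ hφ
      have hφ' : ∀ x, φ (f x) = 0 := fun x => LinearMap.congr_fun hφ x
      have hle : LinearMap.ker g ≤ LinearMap.ker φ := fun x hx => by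
        obtain ⟨x, rfl⟩ := (hfg x).1 hx
        exact hφ' x
      obtain ⟨ψ, hψ⟩ := hR.out ((LinearMap.ker g).liftQ g le_rfl)
        (LinearMap.ker_eq_bot.1 (Submodule.ker_liftQ_eq_bot _ _ _ le_rfl))
        ((LinearMap.ker g).liftQ φ hle)
      have : φ = ψ.comp g := LinearMap.ext fun x => (hψ (Submodule.Quotient.mk x)).symm
      rw [LinearMap.mem_ker, this]
      exact LinearMap.congr_fun hy ψ
    obtain ⟨z, hz⟩ := hS.out ((LinearMap.ker d).liftQ d le_rfl)
      (LinearMap.ker_eq_bot.1 (Submodule.ker_liftQ_eq_bot _ _ _ le_rfl))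
      ((LinearMap.ker d).liftQ y hker)
    exact ⟨z, LinearMap.ext fun φ => hz (Submodule.Quotient.mk φ)⟩
  · rintro ⟨z, rfl⟩
    ext φ
    have : (φ.comp g).comp f = 0 := LinearMap.ext fun x => by
      simp [hfg.apply_apply_eq_zero x]
    simp [this]

/-- Half of the five lemma; injectivity of `f` plays no role, so in applications the image of `k`
can stand in for an embedded copy. -/
lemma bidualMap_surjective_of_exact (f : M →ₗ[R] N) (g : N →ₗ[R] P)
    (hg : Function.Surjective g) (hfg : Function.Exact f g)
    (h : Function.Surjective (bidualMap R S E M)) (h'' : Function.Surjective (bidualMap R S E P)) :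
    Function.Surjective (bidualMap R S E N) := by
  intro y
  obtain ⟨x'', hx''⟩ := h'' (bidualFunc R S E g y)
  obtain ⟨x', rfl⟩ := hg x''
  obtain ⟨w, hw⟩ := (bidualFunc_exact (S := S) f g hfg (y - bidualMap R S E N x')).1 (by
    rw [map_sub, bidualFunc_bidualMap, hx'', sub_self])
  obtain ⟨x, rfl⟩ := h w
  refine ⟨f x + x', ?_⟩
  rw [map_add, ← bidualFunc_bidualMap, hw, sub_add_cancel]

end Bidual

/-! ### Endomorphisms of the injective hull, and its artinianness. -/

section Endomorphisms

variable {R : Type u} [CommRing R] [IsLocalRing R]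
variable {E : Type u} [AddCommGroup E] [Module R E] {ι : ResidueField R →ₗ[R] E}

lemma IsMaxTorsion.of_surjective {L L' : Type*} [AddCommGroup L] [Module R L] [AddCommGroup L']
    [Module R L'] (h : IsMaxTorsion R L) (f : L →ₗ[R] L') (hf : Function.Surjective f) :
    IsMaxTorsion R L' := by
  intro y
  obtain ⟨x, rfl⟩ := hf y
  obtain ⟨n, hn⟩ := h x
  exact ⟨n, fun a ha => by rw [← map_smul, hn a ha, map_zero]⟩

lemma bidualMap_surjective_of_subsingleton {R : Type u} [CommRing R] (S : Type u) [CommRing S]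
    [Algebra R S] (E : Type u) [AddCommGroup E] [Module R E] [Module S E] [IsScalarTower R S E]
    (M : Type u) [AddCommGroup M] [Module R M] [Subsingleton M] :
    Function.Surjective (bidualMap R S E M) := fun y =>
  ⟨0, by ext φ; rw [Subsingleton.elim φ 0, map_zero, map_zero]⟩

/-- Noetherian torsion modules are reflexive. -/
lemma IsInjectiveHull.bidualMap_surjective_of_isMaxTorsion (hι : IsInjectiveHull ι)
    (M : Type u) [AddCommGroup M] [Module R M] [IsNoetherian R M] (hM : IsMaxTorsion R M) :
    Function.Surjective (bidualMap R R E M) := by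
  have := hι.injective_module
  revert hM
  refine noetherian_quotient_induction
    (P := fun M [AddCommGroup M] [Module R M] =>
      IsMaxTorsion R M → Function.Surjective (bidualMap R R E M)) ?_ M
  intro Q _ _ _ ih hQ
  rcases subsingleton_or_nontrivial Q with hQ0 | hQ0
  · exact bidualMap_surjective_of_subsingleton R E Q
  obtain ⟨y, hy⟩ := exists_ne (0 : Q)
  obtain ⟨n, hn⟩ := hQ y
  obtain ⟨r, hr0, hr⟩ := exists_smul_mem_socle n y hy hn
  obtain ⟨f, hf⟩ := exists_residueField_linearMap (r • y) hr
  refine bidualMap_surjective_of_exact f (LinearMap.range f).mkQ (Submodule.mkQ_surjective _)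
    (LinearMap.exact_iff.2 (Submodule.ker_mkQ _)) (bidualMap_residueField_surjective R hι)
    (ih _ (fun h => hr0 ?_) (hQ.of_surjective _ (Submodule.mkQ_surjective _)))
  rw [← hf]
  exact (Submodule.eq_bot_iff _).1 h _ ⟨1, rfl⟩

lemma isMaxTorsion_quotient_pow (n : ℕ) : IsMaxTorsion R (R ⧸ maximalIdeal R ^ n) := by
  intro x
  obtain ⟨x, rfl⟩ := Submodule.Quotient.mk_surjective _ x
  refine ⟨n, fun a ha => ?_⟩
  rw [← Submodule.Quotient.mk_smul, Submodule.Quotient.mk_eq_zero]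
  exact Ideal.mul_mem_right x _ ha

lemma exists_quotient_linearMap (n : ℕ) {L : Type*} [AddCommGroup L] [Module R L] (x : L)
    (hx : ∀ c ∈ maximalIdeal R ^ n, c • x = 0) :
    ∃ φ : (R ⧸ maximalIdeal R ^ n) →ₗ[R] L, ∀ a : R, φ (Submodule.Quotient.mk a) = a • x :=
  ⟨(maximalIdeal R ^ n).liftQ (LinearMap.toSpanSingleton R L x) fun a ha => by simpa using hx a ha,
    fun a => by rw [Submodule.liftQ_apply, LinearMap.toSpanSingleton_apply]⟩

/-- On the elements of `E` killed by a fixed power of the maximal ideal, an endomorphism of `E` is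
multiplication by an element of the ring. -/
lemma IsInjectiveHull.exists_forall_apply_eq_smul [IsNoetherianRing R] (hι : IsInjectiveHull ι)
    (g : E →ₗ[R] E) (n : ℕ) :
    ∃ a : R, ∀ x : E, (∀ c ∈ maximalIdeal R ^ n, c • x = 0) → g x = a • x := by
  -- Maps `R ⧸ 𝔪ⁿ → E` are the elements of `E` killed by `𝔪ⁿ`, so `g` gives an element of the bidual
  -- of `R ⧸ 𝔪ⁿ`. By reflexivity it is evaluation at the class of some `a`.
  let y : ((R ⧸ maximalIdeal R ^ n) →ₗ[R] E) →ₗ[R] E :=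
    g.comp (LinearMap.applyₗ (Submodule.Quotient.mk 1))
  obtain ⟨a, ha⟩ := hι.bidualMap_surjective_of_isMaxTorsion _ (isMaxTorsion_quotient_pow n) y
  obtain ⟨a, rfl⟩ := Submodule.Quotient.mk_surjective _ a
  refine ⟨a, fun x hx => ?_⟩
  obtain ⟨φ, hφ⟩ := exists_quotient_linearMap n x hx
  rw [← hφ a, ← one_smul R x, ← hφ 1]
  exact (LinearMap.congr_fun ha φ).symm

/-- If `a ∉ 𝔪ⁿ`, the cogenerator `E` detects the class of `a` in `R ⧸ 𝔪ⁿ`; the image of `1` is then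
killed by `𝔪ⁿ` but not by `a`. -/
lemma IsInjectiveHull.mem_pow_of_forall_smul_eq_zero (hι : IsInjectiveHull ι) (n : ℕ) (a : R)
    (ha : ∀ x : E, (∀ c ∈ maximalIdeal R ^ n, c • x = 0) → a • x = 0) :
    a ∈ maximalIdeal R ^ n := by
  by_contra h
  obtain ⟨f, hf⟩ := hι.exists_apply_ne_zero
    (Submodule.Quotient.mk a : R ⧸ maximalIdeal R ^ n)
    (by rwa [Ne, Submodule.Quotient.mk_eq_zero])
  have hfa : ∀ b : R, f (Submodule.Quotient.mk b) = b • f (Submodule.Quotient.mk 1) := fun b => by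
    rw [← map_smul, ← Submodule.Quotient.mk_smul, smul_eq_mul, mul_one]
  refine hf ((hfa a).trans (ha _ fun c hc => ?_))
  rw [← hfa, (Submodule.Quotient.mk_eq_zero _).2 hc, map_zero]

/-- The filtration of the ring attached to a submodule `U` of `E`, whose `n`-th term consists of the
elements of `𝔪ⁿ` that kill the part of `U` killed by `𝔪ⁿ⁺¹`. -/
def annihilatorFiltration (U : Submodule R E) : (maximalIdeal R).Filtration R where
  -- Elements of `𝔪ⁿ` carry the part of `E` killed by `𝔪ⁿ⁺¹` into the socle. The `n`-th term is the
  -- orthogonal of `U` under this pairing, whence the shift by one.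
  N n :=
    { carrier := {a | a ∈ maximalIdeal R ^ n ∧
        ∀ u ∈ U, (∀ c ∈ maximalIdeal R ^ (n + 1), c • u = 0) → a • u = 0}
      zero_mem' := ⟨zero_mem _, fun u _ _ => zero_smul R u⟩
      add_mem' := fun ha hb => ⟨add_mem ha.1 hb.1, fun u hu h => by
        rw [add_smul, ha.2 u hu h, hb.2 u hu h, add_zero]⟩
      smul_mem' := fun r a ha => ⟨Submodule.smul_mem _ r ha.1, fun u hu h => by
        rw [smul_assoc, ha.2 u hu h, smul_zero]⟩ }
  mono n := fun a ha => ⟨Ideal.pow_le_pow_right n.le_succ ha.1, fun u hu h =>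
    ha.2 u hu fun c hc => h c (Ideal.pow_le_pow_right (Nat.le_succ _) hc)⟩
  smul_le n := by
    refine Submodule.smul_le.2 fun r hr a ha => ⟨?_, fun u hu h => ?_⟩
    · rw [pow_succ']
      exact Ideal.mul_mem_mul hr ha.1
    · rw [smul_eq_mul, mul_comm, mul_smul]
      refine ha.2 _ (U.smul_mem r hu) fun c hc => ?_
      rw [← mul_smul]
      exact h _ (by rw [pow_succ]; exact Ideal.mul_mem_mul hc hr)

lemma mem_annihilatorFiltration {U : Submodule R E} {n : ℕ} {a : R} :
    a ∈ (annihilatorFiltration U).N n ↔ a ∈ maximalIdeal R ^ n ∧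
        ∀ u ∈ U, (∀ c ∈ maximalIdeal R ^ (n + 1), c • u = 0) → a • u = 0 := Iff.rfl

lemma annihilatorFiltration_antitone {U U' : Submodule R E} (h : U' ≤ U) (n : ℕ) :
    (annihilatorFiltration U).N n ≤ (annihilatorFiltration U').N n :=
  fun _ ha => ⟨ha.1, fun u hu => ha.2 u (h hu)⟩

/-- The filtration determines `U` among larger and smaller submodules, layer by layer. If `u ∈ U`
killed by `𝔪ⁿ⁺¹` is not in `U'`, an endomorphism of `E` separates `u` from `U'` and from everything
killed by `𝔪ⁿ`. On elements killed by `𝔪ⁿ⁺¹` it is multiplication by some `a`, which lies in the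
filtration of `U'` but not in that of `U`. -/
lemma IsInjectiveHull.le_of_annihilatorFiltration_le [IsNoetherianRing R] (hι : IsInjectiveHull ι)
    {U U' : Submodule R E} (hU : U' ≤ U)
    (h : ∀ n, (annihilatorFiltration U').N n ≤ (annihilatorFiltration U).N n) : U ≤ U' := by
  have key : ∀ (n : ℕ) (u : E), u ∈ U → (∀ c ∈ maximalIdeal R ^ n, c • u = 0) → u ∈ U' := by
    intro n
    induction n with
    | zero =>
      intro u _ hu
      have : u = 0 := by simpa using hu 1 (by simp)
      exact this ▸ zero_mem _
    | succ n ih =>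
      intro u huU hu
      by_contra hu'
      let T : ℕ → Submodule R E := fun n =>
        { carrier := {x | ∀ c ∈ maximalIdeal R ^ n, c • x = 0}
          zero_mem' := fun c _ => smul_zero c
          add_mem' := fun hx hy c hc => by rw [smul_add, hx c hc, hy c hc, add_zero]
          smul_mem' := fun r x hx c hc => by rw [smul_comm, hx c hc, smul_zero] }
      have huV : u ∉ U' ⊔ T n := fun hV => by
        obtain ⟨v, hv, e, he, rfl⟩ := Submodule.mem_sup.1 hV
        have heU : e ∈ U := by simpa using sub_mem huU (hU hv)
        exact hu' (add_mem hv (ih e heU he))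
      obtain ⟨f, hf, hfu⟩ := hι.exists_apply_ne_zero_of_notMem _ u huV
      obtain ⟨a, ha⟩ := hι.exists_forall_apply_eq_smul f (n + 1)
      have hmem : a ∈ (annihilatorFiltration U').N n := by
        refine mem_annihilatorFiltration.2
          ⟨hι.mem_pow_of_forall_smul_eq_zero n a fun x hx => ?_, fun v hv hv' => ?_⟩
        · rw [← ha x fun c hc => hx c (Ideal.pow_le_pow_right n.le_succ hc)]
          exact hf x (Submodule.mem_sup_right hx)
        · rw [← ha v hv']
          exact hf v (Submodule.mem_sup_left hv)
      exact hfu ((ha u hu).trans ((h n hmem).2 u huU hu))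
  intro u hu
  obtain ⟨n, hn⟩ := hι.isMaxTorsion u
  exact key n u hu hn

/-- The injective hull of the residue field of a noetherian local ring is artinian. -/
theorem IsInjectiveHull.isArtinian [IsNoetherianRing R] (hι : IsInjectiveHull ι) :
    IsArtinian R E := by
  rw [← monotone_stabilizes_iff_artinian]
  intro U
  let F : ℕ → (maximalIdeal R).Filtration R := fun j =>
    annihilatorFiltration (OrderDual.ofDual (U j))
  have hF : ∀ n, Monotone fun j => (F j).N n := fun n i j hij =>
    annihilatorFiltration_antitone (U.monotone hij) n
  -- A filtration contained in the `𝔪`-adic one is stable, because `R` is noetherian. Thus from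
  -- degree `n₀` on, the supremum is determined by its term in degree `n₀`.
  obtain ⟨n₀, hn₀⟩ : (iSup F).Stable := by
    refine ((maximalIdeal R).stableFiltration_stable (⊤ : Submodule R R)).of_le
      (iSup_le fun j n a ha => ?_)
    simpa using ha.1
  have hstab : ∀ n, ∃ j, (iSup F).N n ≤ (F j).N n := by
    intro n
    obtain ⟨j, hj⟩ := monotone_stabilizes_iff_noetherian.2 ‹IsNoetherianRing R› ⟨_, hF n⟩
    refine ⟨j, ?_⟩
    rw [Ideal.Filtration.iSup_N, iSup_apply]
    refine iSup_le fun i => ?_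
    rcases le_total i j with hij | hij
    · exact hF n hij
    · exact (hj i hij).ge
  choose j hj using hstab
  -- The degrees `0, …, n₀` stabilize by `j₁`; higher degrees follow by multiplying with `𝔪`.
  let j₁ := (Finset.range (n₀ + 1)).sup j
  have hle : ∀ n, (iSup F).N n ≤ (F j₁).N n := by
    intro n
    rcases le_total n n₀ with hn | hn
    · exact (hj n).trans (hF n (Finset.le_sup (Finset.mem_range.2 (Nat.lt_succ_of_le hn))))
    · induction n, hn using Nat.le_induction with
      | base =>
        exact (hj n₀).trans (hF n₀ (Finset.le_sup (Finset.mem_range.2 (Nat.lt_succ_self _))))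
      | succ n hn ih =>
        rw [← hn₀ n hn]
        exact (Submodule.smul_mono le_rfl ih).trans ((F j₁).smul_le n)
  refine ⟨j₁, fun i hi => ?_⟩
  refine le_antisymm (U.monotone hi) ?_
  refine hι.le_of_annihilatorFiltration_le (U.monotone hi) fun n => ?_
  refine le_trans ?_ (hle n)
  rw [Ideal.Filtration.iSup_N, iSup_apply]
  exact le_iSup (fun j => (F j).N n) i

end Endomorphisms

/-! ### The completion is the endomorphism ring of the injective hull. -/

section Completion

variable {R : Type u} [CommRing R] [IsLocalRing R]

lemma completionAction_apply {L : Type*} [AddCommGroup L] [Module R L] (h : IsMaxTorsion R L)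
    (r : AdicCompletion (maximalIdeal R) R) (x : L) (n : ℕ)
    (hn : ∀ a ∈ maximalIdeal R ^ n, a • x = 0) (r₀ : R)
    (hr : AdicCompletion.evalₐ (maximalIdeal R) n r = Ideal.Quotient.mk _ r₀) :
    completionAction h r x = r₀ • x :=
  completionSMul_eq h r x n hn r₀ hr

/-- One representative `r₀` computes the action on both `x` and `f x`. With target `E` this makes
the action through `A` agree with the action through `E`. -/
lemma map_completionAction {L L' : Type*} [AddCommGroup L] [Module R L] [AddCommGroup L']
    [Module R L'] (h : IsMaxTorsion R L) (h' : IsMaxTorsion R L') (f : L →ₗ[R] L')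
    (r : AdicCompletion (maximalIdeal R) R) (x : L) :
    f (completionAction h r x) = completionAction h' r (f x) := by
  obtain ⟨n, hn⟩ := h x
  obtain ⟨r₀, hr⟩ := Ideal.Quotient.mk_surjective (AdicCompletion.evalₐ (maximalIdeal R) n r)
  rw [completionAction_apply h r x n hn r₀ hr.symm,
    completionAction_apply h' r (f x) n (fun a ha => by rw [← map_smul, hn a ha, map_zero]) r₀
      hr.symm, map_smul]

lemma completionAction_algebraMap {L : Type*} [AddCommGroup L] [Module R L]
    (h : IsMaxTorsion R L) (a : R) (x : L) :
    completionAction h (algebraMap R (AdicCompletion (maximalIdeal R) R) a) x = a • x := by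
  obtain ⟨n, hn⟩ := h x
  exact completionAction_apply h _ x n hn a (AlgHom.commutes _ a)

variable [IsNoetherianRing R]
variable {E : Type u} [AddCommGroup E] [Module R E] {ι : ResidueField R →ₗ[R] E}

/-- Every endomorphism of `E` is multiplication by an element of the completion. -/
lemma IsInjectiveHull.completionAction_surjective (hι : IsInjectiveHull ι) :
    Function.Surjective (completionAction hι.isMaxTorsion) := by
  intro g
  choose a ha using hι.exists_forall_apply_eq_smul g
  -- Both scalars act as `g` on the elements killed by `𝔪ⁿ`, and the annihilator of those elements
  -- lies in `𝔪ⁿ`.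
  have hcompat : ∀ n, a n ≡ a (n + 1)
      [SMOD (maximalIdeal R ^ n • ⊤ : Submodule R R)] := fun n => by
    rw [SModEq.sub_mem]
    have : a n - a (n + 1) ∈ maximalIdeal R ^ n :=
      hι.mem_pow_of_forall_smul_eq_zero n _ fun x hx => by
        rw [sub_smul, ← ha n x hx,
          ← ha (n + 1) x fun c hc => hx c (Ideal.pow_le_pow_right n.le_succ hc), sub_self]
    simpa using this
  refine ⟨AdicCompletion.mk _ _ (AdicCompletion.AdicCauchySequence.mk _ _ a hcompat), ?_⟩
  ext x
  obtain ⟨n, hn⟩ := hι.isMaxTorsion x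
  rw [completionAction_apply _ _ x n hn (a n) (AdicCompletion.evalₐ_mk _ _ _), ha n x hn]

lemma IsInjectiveHull.completionAction_injective (hι : IsInjectiveHull ι) :
    Function.Injective (completionAction hι.isMaxTorsion) := by
  rw [injective_iff_map_eq_zero]
  intro r hr
  refine AdicCompletion.ext_evalₐ fun n => ?_
  obtain ⟨r₀, hr₀⟩ := Ideal.Quotient.mk_surjective (AdicCompletion.evalₐ (maximalIdeal R) n r)
  rw [map_zero, ← hr₀, Ideal.Quotient.eq_zero_iff_mem]
  refine hι.mem_pow_of_forall_smul_eq_zero n r₀ fun x hx => ?_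
  rw [← completionAction_apply hι.isMaxTorsion r x n hx r₀ hr₀.symm, hr, LinearMap.zero_apply]

end Completion

/-! ### Noetherian duals, injectivity over the completion, reflexivity of artinian modules. -/

section Reflexivity

/-- If every `R`-endomorphism of `E` is multiplication by an element of `S`, then every `R`-linear
form on a finite power of `E` is an `S`-combination of the coordinates. -/
lemma exists_forall_apply_eq_sum_smul {R S E : Type*} [CommRing R] [CommRing S] [AddCommGroup E]
    [Module R E] [Module S E]
    (hsurj : ∀ g : E →ₗ[R] E, ∃ s : S, ∀ x, g x = s • x) {t : Type*} [Fintype t]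
    (φ : (t → E) →ₗ[R] E) : ∃ s : t → S, ∀ w, φ w = ∑ i, s i • w i := by
  classical
  choose s hs using fun i => hsurj (φ.comp (LinearMap.single R (fun _ => E) i))
  refine ⟨s, fun w => ?_⟩
  conv_lhs => rw [← LinearMap.sum_single_apply (fun _ => E) w, map_sum]
  exact Finset.sum_congr rfl fun i _ => hs i (w i)

variable {R : Type u} [CommRing R] {S : Type u} [CommRing S] [Algebra R S]
variable {E : Type u} [AddCommGroup E] [Module R E] [Module S E] [IsScalarTower R S E]

/-- If every `R`-endomorphism of `E` is multiplication by an element of `S`, then a linear form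
that vanishes on the common zeros of finitely many forms is an `S`-combination of them. -/
lemma mem_span_of_forall_apply_eq_zero [hR : Module.Injective R E]
    (hsurj : ∀ g : E →ₗ[R] E, ∃ s : S, ∀ x, g x = s • x)
    {A : Type u} [AddCommGroup A] [Module R A] (t : Finset (A →ₗ[R] E)) (f : A →ₗ[R] E)
    (hf : ∀ a, (∀ g ∈ t, g a = 0) → f a = 0) :
    f ∈ Submodule.span S (t : Set (A →ₗ[R] E)) := by
  classical
  -- The form `f` factors through the image of `θ` and extends to `E^t`, where forms are
  -- combinations of coordinates.
  let θ : A →ₗ[R] (t → E) := LinearMap.pi fun g => g.1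
  have hle : LinearMap.ker θ ≤ LinearMap.ker f := fun a ha =>
    hf a fun g hg => congrFun (LinearMap.mem_ker.1 ha) ⟨g, hg⟩
  obtain ⟨h, hh⟩ := hR.out ((LinearMap.ker θ).liftQ θ le_rfl)
    (LinearMap.ker_eq_bot.1 (Submodule.ker_liftQ_eq_bot _ _ _ le_rfl))
    ((LinearMap.ker θ).liftQ f hle)
  obtain ⟨s, hs⟩ := exists_forall_apply_eq_sum_smul hsurj h
  have hfs : f = ∑ g : t, s g • g.1 := by
    ext a
    rw [LinearMap.sum_apply]
    refine (hh (Submodule.Quotient.mk a)).symm.trans ?_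
    exact hs (θ a)
  rw [hfs]
  exact sum_mem fun g _ => Submodule.smul_mem _ _ (Submodule.subset_span g.2)

/-- The dual of an artinian module is noetherian. -/
theorem isNoetherian_dual [hR : Module.Injective R E]
    (hsurj : ∀ g : E →ₗ[R] E, ∃ s : S, ∀ x, g x = s • x)
    (A : Type u) [AddCommGroup A] [Module R A] [IsArtinian R A] :
    IsNoetherian S (A →ₗ[R] E) := by
  classical
  refine ⟨fun Y => ?_⟩
  let perp : Finset (A →ₗ[R] E) → Submodule R A := fun t => ⨅ g ∈ t, LinearMap.ker g
  -- A finite subset of `Y` with minimal common kernel generates `Y`: adjoining another `f ∈ Y`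
  -- cannot shrink that kernel, so `f` vanishes on it.
  obtain ⟨_, ⟨t, ht, rfl⟩, hmin⟩ := IsArtinian.set_has_minimal
    (perp '' {t | (t : Set (A →ₗ[R] E)) ⊆ Y}) ⟨_, ∅, by simp, rfl⟩
  refine ⟨t, le_antisymm (Submodule.span_le.2 ht) fun f hf => ?_⟩
  refine mem_span_of_forall_apply_eq_zero hsurj t f fun a ha => ?_
  have hle : perp (insert f t) ≤ perp t :=
    le_iInf₂ fun g hg => iInf₂_le g (Finset.mem_insert_of_mem hg)
  have heq : perp (insert f t) = perp t := by
    by_contra h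
    exact hmin _ ⟨_, by simpa [Set.insert_subset_iff] using ⟨hf, ht⟩, rfl⟩
      (lt_of_le_of_ne hle h)
  have hat : a ∈ perp t := by simpa [perp] using ha
  rw [← heq] at hat
  exact (iInf₂_le (f := fun (g : A →ₗ[R] E) (_ : g ∈ insert f t) => LinearMap.ker g) f
    (Finset.mem_insert_self f t)) hat

variable (R S E) in
/-- The module `S` embeds into the dual of a faithful module `E`. -/
def toDual : S →ₗ[S] (E →ₗ[R] E) where
  toFun s :=
    { toFun x := s • x
      map_add' := smul_add s
      map_smul' r x := smul_comm s r x }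
  map_add' s t := by ext x; exact add_smul s t x
  map_smul' s t := by ext x; exact mul_smul s t x

/-- By faithfulness `S` embeds in the dual of `E`, which is noetherian because `E` is artinian. -/
theorem isNoetherianRing_of_isArtinian [Module.Injective R E] [IsArtinian R E]
    (hsurj : ∀ g : E →ₗ[R] E, ∃ s : S, ∀ x, g x = s • x)
    (hinj : ∀ s : S, (∀ x : E, s • x = 0) → s = 0) : IsNoetherianRing S := by
  have := isNoetherian_dual hsurj E
  refine isNoetherian_of_injective (toDual R S E) ?_
  rw [injective_iff_map_eq_zero]
  exact fun s hs => hinj s fun x => LinearMap.congr_fun hs x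

/-- Forms on `E^t` are `S`-combinations of coordinates, so the values of `y` on the coordinates give
the required tuple. -/
lemma bidualMap_pi_surjective (hsurj : ∀ g : E →ₗ[R] E, ∃ s : S, ∀ x, g x = s • x)
    (t : Type u) [Finite t] : Function.Surjective (bidualMap R S E (t → E)) := by
  classical
  have := Fintype.ofFinite t
  intro y
  refine ⟨fun i => y (LinearMap.proj i), ?_⟩
  ext φ
  obtain ⟨s, hsum⟩ := exists_forall_apply_eq_sum_smul hsurj φ
  have hφ : φ = ∑ i, s i • (LinearMap.proj i : (t → E) →ₗ[R] E) := by
    refine LinearMap.ext fun w => ?_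
    rw [hsum, LinearMap.sum_apply]
    rfl
  rw [bidualMap_apply, hsum]
  conv_rhs => rw [hφ, map_sum]
  simp only [map_smul]

variable [IsLocalRing R] {ι : ResidueField R →ₗ[R] E}

/-- The injective hull of the residue field is injective over the completion. -/
theorem IsInjectiveHull.injective_of_isNoetherianRing (hι : IsInjectiveHull ι)
    [IsNoetherianRing S]
    (hsurj : ∀ g : E →ₗ[R] E, ∃ s : S, ∀ x, g x = s • x)
    (hinj : ∀ s : S, (∀ x : E, s • x = 0) → s = 0) : Module.Injective S E := by
  classical
  refine Module.Baer.injective fun J f => ?_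
  obtain ⟨t, ht⟩ := IsNoetherian.noetherian J
  have htJ : ∀ s : t, s.1 ∈ J := fun s => ht ▸ Submodule.subset_span s.2
  let θ : E →ₗ[R] (t → E) := LinearMap.pi fun s => toDual R S E s.1
  let v : t → E := fun s => f ⟨s.1, htJ s⟩
  -- Otherwise a form on `E^t` with coefficients `c` kills the range of `θ` but not `v`. By
  -- faithfulness the first says that `c` is a relation among the generators of `J`; `f` respects
  -- it, so the form kills `v` after all.
  have hv : v ∈ LinearMap.range θ := by
    by_contra hv
    obtain ⟨h, hh, hhv⟩ := hι.exists_apply_ne_zero_of_notMem _ v hv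
    obtain ⟨c, hsum⟩ := exists_forall_apply_eq_sum_smul hsurj h
    have hrel : ∑ s : t, c s * s.1 = 0 := hinj _ fun x => by
      rw [Finset.sum_smul, ← hh _ ⟨x, rfl⟩, hsum]
      exact Finset.sum_congr rfl fun s _ => mul_smul _ _ _
    refine hhv ?_
    rw [hsum]
    have : ∑ s : t, c s • (⟨s.1, htJ s⟩ : J) = 0 := by
      ext
      simpa using hrel
    calc ∑ s : t, c s • v s = f (∑ s : t, c s • (⟨s.1, htJ s⟩ : J)) := by
          rw [map_sum]
          exact Finset.sum_congr rfl fun s _ => (map_smul f _ _).symm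
      _ = 0 := by rw [this, map_zero]
  obtain ⟨y, hy⟩ := hv
  refine ⟨LinearMap.toSpanSingleton S E y, fun x hx => ?_⟩
  have key : ∀ x (_ : x ∈ Submodule.span S (t : Set S)) (hx : x ∈ J), x • y = f ⟨x, hx⟩ := by
    intro x hxt
    induction hxt using Submodule.span_induction with
    | mem x h => exact fun hx => congrFun hy ⟨x, h⟩
    | zero => exact fun hx => by rw [zero_smul]; exact (map_zero f).symm
    | add x z hx' hz' ihx ihz =>
      intro hxz
      rw [add_smul, ihx (ht ▸ hx'), ihz (ht ▸ hz'), ← map_add]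
      rfl
    | smul s x hx' ih =>
      intro hsx
      rw [smul_assoc, ih (ht ▸ hx'), ← map_smul]
      rfl
  rw [LinearMap.toSpanSingleton_apply]
  exact key x (ht ▸ hx) hx

/-- Artinian modules are reflexive. -/
theorem IsInjectiveHull.bidualMap_surjective_of_isArtinian (hι : IsInjectiveHull ι)
    [hS : Module.Injective S E]
    (hsurj : ∀ g : E →ₗ[R] E, ∃ s : S, ∀ x, g x = s • x)
    (A : Type u) [AddCommGroup A] [Module R A] [IsArtinian R A] :
    Function.Surjective (bidualMap R S E A) := by
  have := hι.injective_module
  have := isNoetherian_dual (S := S) hsurj A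
  obtain ⟨t, ht⟩ := IsNoetherian.noetherian (⊤ : Submodule S (A →ₗ[R] E))
  -- Finitely many generators of the dual embed `A` in `E^t`, since `E` is a cogenerator.
  let j : A →ₗ[R] (t → E) := LinearMap.pi fun g => g.1
  have hj : Function.Injective j := by
    rw [← LinearMap.ker_eq_bot, Submodule.eq_bot_iff]
    intro a ha
    by_contra h
    obtain ⟨f, hf⟩ := hι.exists_apply_ne_zero a h
    apply hf
    clear hf
    have hft : f ∈ Submodule.span S (t : Set (A →ₗ[R] E)) := ht ▸ trivial
    induction hft using Submodule.span_induction with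
    | mem g h => exact congrFun (LinearMap.mem_ker.1 ha) ⟨g, h⟩
    | zero => rfl
    | add f g _ _ hf hg => rw [LinearMap.add_apply, hf, hg, add_zero]
    | smul s f _ hf => rw [LinearMap.smul_apply, hf, smul_zero]
  intro y
  obtain ⟨x, hx⟩ := bidualMap_pi_surjective (R := R) hsurj t (bidualFunc R S E j y)
  -- The bidual of `E^t ⧸ A` kills whatever comes from the bidual of `A`, and evaluation on `E^t ⧸
  -- A` is injective; so `x` lies in `A`.
  have hq : (LinearMap.range j).mkQ x = 0 := by
    refine bidualMap_injective S hι ?_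
    rw [← bidualFunc_bidualMap, hx, map_zero]
    refine (bidualFunc_exact (S := S) j (LinearMap.range j).mkQ
      (LinearMap.exact_iff.2 (Submodule.ker_mkQ _)) _).2 ⟨y, rfl⟩
  obtain ⟨a, rfl⟩ : x ∈ LinearMap.range j := by simpa using hq
  exact ⟨a, bidualFunc_injective j hj (by rw [← hx, bidualFunc_bidualMap])⟩

end Reflexivity

/-! ### Exactness of the cokernel of evaluation. -/

section Cokernel

variable (R : Type u) [CommRing R] (S : Type u) [CommRing S] [Algebra R S]
variable (E : Type u) [AddCommGroup E] [Module R E] [Module S E] [IsScalarTower R S E]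
variable (M : Type u) [AddCommGroup M] [Module R M]

/-- The cokernel of the evaluation map into the bidual. -/
abbrev BidualCoker : Type u := ((M →ₗ[R] E) →ₗ[S] E) ⧸ LinearMap.range (bidualMap R S E M)

variable {M} {N P : Type u} [AddCommGroup N] [Module R N] [AddCommGroup P] [Module R P]

/-- Functoriality of the cokernel of the evaluation map. -/
def bidualCokerMap (f : M →ₗ[R] N) : BidualCoker R S E M →ₗ[R] BidualCoker R S E N :=
  Submodule.mapQ _ _ (bidualFunc R S E f) (by rintro _ ⟨x, rfl⟩; exact ⟨f x, rfl⟩)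

lemma bidualCokerMap_smul (r : R) (x : BidualCoker R S E M) :
    bidualCokerMap R S E (r • LinearMap.id) x = r • x := by
  obtain ⟨y, rfl⟩ := Submodule.Quotient.mk_surjective _ x
  rw [bidualCokerMap, Submodule.mapQ_apply, ← Submodule.Quotient.mk_smul]
  congr 1
  ext φ
  have : φ.comp (r • LinearMap.id) = r • φ := by ext; simp
  rw [bidualFunc_apply, this, y.map_smul_of_tower, LinearMap.smul_apply]

variable {E} [IsLocalRing R] {ι : ResidueField R →ₗ[R] E}

/-- The cokernel of the evaluation map is an exact functor. -/
lemma IsInjectiveHull.bidualCoker_shortExact (hι : IsInjectiveHull ι) [Module.Injective S E]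
    (f : M →ₗ[R] N) (g : N →ₗ[R] P) (hf : Function.Injective f)
    (hg : Function.Surjective g) (hfg : Function.Exact f g) :
    Function.Injective (bidualCokerMap R S E f) ∧
    Function.Exact (bidualCokerMap R S E f) (bidualCokerMap R S E g) ∧
    Function.Surjective (bidualCokerMap R S E g) := by
  have := hι.injective_module
  -- Evaluation is a natural monomorphism between exact functors; what follows is the nine lemma for
  -- its cokernel.
  have hex := bidualFunc_exact (S := S) (E := E) f g hfg
  refine ⟨?_, fun x => ⟨?_, ?_⟩, ?_⟩
  · rw [← LinearMap.ker_eq_bot, Submodule.eq_bot_iff]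
    intro x hx
    obtain ⟨y, rfl⟩ := Submodule.Quotient.mk_surjective _ x
    obtain ⟨z, hz⟩ := (Submodule.Quotient.mk_eq_zero _).1 hx
    have hgz : g z = 0 := bidualMap_injective S hι (by
      rw [← bidualFunc_bidualMap, hz, map_zero]
      exact hex.apply_apply_eq_zero y)
    obtain ⟨w, rfl⟩ := (hfg z).1 hgz
    rw [Submodule.Quotient.mk_eq_zero]
    exact ⟨w, bidualFunc_injective f hf (by rw [bidualFunc_bidualMap, hz])⟩
  · intro hx
    obtain ⟨y, rfl⟩ := Submodule.Quotient.mk_surjective _ x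
    obtain ⟨z, hz⟩ := (Submodule.Quotient.mk_eq_zero _).1 hx
    obtain ⟨w, rfl⟩ := hg z
    obtain ⟨v, hv⟩ := (hex (y - bidualMap R S E N w)).1 (by
      rw [map_sub, ← hz, bidualFunc_bidualMap, sub_self])
    refine ⟨Submodule.Quotient.mk v, ?_⟩
    rw [bidualCokerMap, Submodule.mapQ_apply, hv, Submodule.Quotient.eq]
    exact ⟨-w, by rw [map_neg]; abel⟩
  · rintro ⟨v, rfl⟩
    obtain ⟨y, rfl⟩ := Submodule.Quotient.mk_surjective _ v
    rw [bidualCokerMap, bidualCokerMap, Submodule.mapQ_apply, Submodule.mapQ_apply,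
      hex.apply_apply_eq_zero y, Submodule.Quotient.mk_zero]
  · intro x
    obtain ⟨y, rfl⟩ := Submodule.Quotient.mk_surjective _ x
    obtain ⟨z, rfl⟩ := bidualFunc_surjective g hg y
    exact ⟨Submodule.Quotient.mk z, rfl⟩

end Cokernel

/-! ### Vanishing of Ext, and its passage from the residue field to torsion modules. -/

section ExtVanishing

open Abelian

variable {R : Type u} [CommRing R]

lemma shortExact_of_exact {M M' M'' : Type u} [AddCommGroup M] [Module R M] [AddCommGroup M']
    [Module R M'] [AddCommGroup M''] [Module R M''] {f : M →ₗ[R] M'} {g : M' →ₗ[R] M''}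
    (hf : Function.Injective f) (hg : Function.Surjective g) (hfg : Function.Exact f g) :
    (ModuleCat.shortComplexOfCompEqZero f g hfg.linearMap_comp_eq_zero).ShortExact where
  exact := ModuleCat.shortComplex_exact _ hfg
  mono_f := (ModuleCat.mono_iff_injective _).2 hf
  epi_g := (ModuleCat.epi_iff_surjective _).2 hg

/-- All the groups `Ext^i(X, C)` vanish. -/
def ExtVanishes (R : Type u) [CommRing R] (X C : Type u) [AddCommGroup X] [Module R X]
    [AddCommGroup C] [Module R C] : Prop :=
  ∀ (i : ℕ) (e : Ext (ModuleCat.of R X) (ModuleCat.of R C) i), e = 0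

lemma ExtVanishes.of_subsingleton (X C : Type u) [AddCommGroup X] [Module R X]
    [AddCommGroup C] [Module R C] [Subsingleton C] : ExtVanishes R X C := by
  intro i e
  rw [← e.comp_mk₀_id, show 𝟙 (ModuleCat.of R C) = 0 by ext; exact Subsingleton.elim _ _,
    Ext.mk₀_zero, Ext.comp_zero]

lemma ExtVanishes.of_exact {X M M' M'' : Type u} [AddCommGroup X] [Module R X] [AddCommGroup M]
    [Module R M] [AddCommGroup M'] [Module R M'] [AddCommGroup M''] [Module R M'']
    {f : M →ₗ[R] M'} {g : M' →ₗ[R] M''}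
    (hf : Function.Injective f) (hg : Function.Surjective g) (hfg : Function.Exact f g)
    (h : ExtVanishes R X M) (h'' : ExtVanishes R X M'') : ExtVanishes R X M' := by
  intro i e
  obtain ⟨x, rfl⟩ := Ext.covariant_sequence_exact₂ _ (shortExact_of_exact hf hg hfg) e (h'' i _)
  rw [h i x, Ext.zero_comp]

/-- If multiplication by an element killing `X` is injective on `C`, and all `Ext^i(X, -)` of its
cokernel vanish, then all `Ext^i(X, C)` vanish. -/
lemma ExtVanishes.of_smul_injective {X C C' : Type u} [AddCommGroup X] [Module R X]
    [AddCommGroup C] [Module R C] [AddCommGroup C'] [Module R C'] (r : R)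
    (hr : ∀ x : X, r • x = 0) {f : C →ₗ[R] C} (hfr : ∀ c, f c = r • c) {g : C →ₗ[R] C'}
    (hf : Function.Injective f) (hg : Function.Surjective g) (hfg : Function.Exact f g)
    (h : ExtVanishes R X C') : ExtVanishes R X C := by
  intro i e
  -- Vanishing for `C'` makes every class a multiple `r • e'`; letting `r` act on `X` instead shows
  -- that it is zero.
  obtain ⟨e', rfl⟩ := Ext.covariant_sequence_exact₂ _ (shortExact_of_exact hf hg hfg) e (h i _)
  have h1 : ModuleCat.ofHom f = r • 𝟙 (ModuleCat.of R C) := by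
    ext c
    exact hfr c
  have h2 : r • 𝟙 (ModuleCat.of R X) = 0 := by
    ext x
    exact hr x
  change e'.comp (Ext.mk₀ (ModuleCat.ofHom f)) (add_zero i) = 0
  rw [h1, ← Ext.smul_eq_comp_mk₀]
  conv_lhs => rw [← e'.mk₀_id_comp, ← Ext.smul_comp, ← Ext.mk₀_smul, h2, Ext.mk₀_zero,
    Ext.zero_comp]

lemma ExtVanishes.linearMap_eq_zero {X C : Type u} [AddCommGroup X] [Module R X]
    [AddCommGroup C] [Module R C] (h : ExtVanishes R X C) (f : X →ₗ[R] C) : f = 0 := by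
  have := (Ext.mk₀_bijective (ModuleCat.of R X) (ModuleCat.of R C)).1
    ((h 0 (Ext.mk₀ (ModuleCat.ofHom f))).trans (Ext.mk₀_zero _ _).symm)
  exact congrArg ModuleCat.Hom.hom this

variable [IsLocalRing R]

/-- A nonzero value `f a` is killed by a power of `𝔪`, so some multiple of it is a nonzero socle
element of `C`. -/
lemma linearMap_eq_zero_of_isMaxTorsion {A C : Type u} [AddCommGroup A] [Module R A]
    [AddCommGroup C] [Module R C] (hA : IsMaxTorsion R A)
    (hC : ∀ φ : ResidueField R →ₗ[R] C, φ = 0) (f : A →ₗ[R] C) : f = 0 := by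
  ext a
  by_contra h
  obtain ⟨n, hn⟩ := hA a
  obtain ⟨r, hr0, hr⟩ := exists_smul_mem_socle n (f a) h fun c hc => by
    rw [← map_smul, hn c hc, map_zero]
  obtain ⟨φ, hφ⟩ := exists_residueField_linearMap (r • f a) hr
  exact hr0 (by rw [← hφ, hC φ, LinearMap.zero_apply])

/-- By essentiality a nonzero image of `k` in `I` would meet `C`, giving a socle element there. -/
lemma linearMap_eq_zero_of_isInjectiveHull {C I : Type u} [AddCommGroup C] [Module R C]
    [AddCommGroup I] [Module R I] {j : C →ₗ[R] I} (hj : IsInjectiveHull j)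
    (hC : ∀ φ : ResidueField R →ₗ[R] C, φ = 0) (φ : ResidueField R →ₗ[R] I) : φ = 0 := by
  have hker : ∀ a ∈ maximalIdeal R, ∀ z, a • φ z = 0 := fun a ha z => by
    rw [← map_smul, smul_residueField_eq_zero ha, map_zero]
  have : LinearMap.range φ = ⊥ := by
    refine hj.essential _ ((Submodule.eq_bot_iff _).2 ?_)
    rintro _ ⟨⟨z, rfl⟩, c, hc⟩
    obtain ⟨ψ, hψ⟩ := exists_residueField_linearMap c fun a ha => hj.injective <| by
      rw [map_smul, hc, hker a ha, map_zero]
    rw [← hc, ← hψ, hC ψ, LinearMap.zero_apply, map_zero]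
  exact LinearMap.range_eq_bot.1 this

/-- If all `Ext^i(k, C)` vanish, then so do all `Ext^i(A, C)` for `A` torsion. -/
theorem ExtVanishes.of_isMaxTorsion {A : Type u} [AddCommGroup A] [Module R A]
    (hA : IsMaxTorsion R A) {C : Type u} [AddCommGroup C] [Module R C]
    (hC : ExtVanishes R (ResidueField R) C) : ExtVanishes R A C := by
  intro i
  induction i generalizing C with
  | zero =>
    intro e
    obtain ⟨f, rfl⟩ := (Ext.mk₀_bijective (ModuleCat.of R A) (ModuleCat.of R C)).2 e
    have : f = 0 := ModuleCat.hom_ext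
      (linearMap_eq_zero_of_isMaxTorsion hA hC.linearMap_eq_zero f.hom)
    rw [this, Ext.mk₀_zero]
  | succ i ih =>
    intro e
    -- An injective hull, not just any injective module: it keeps `Hom(k, I) = 0`, so `I ⧸ C`
    -- inherits the hypothesis and the degree can be shifted.
    obtain ⟨I, _, _, j, hj⟩ := exists_isInjectiveHull R C
    have hI := hj.injective_module
    have : Injective (ModuleCat.of R I) := Module.injective_object_of_injective_module R I
    have hS := shortExact_of_exact hj.injective (LinearMap.range j).mkQ_surjective
      (LinearMap.exact_iff.2 (Submodule.ker_mkQ _))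
    have hkI : ExtVanishes R (ResidueField R) I := by
      intro n x
      cases n with
      | zero =>
        obtain ⟨f, rfl⟩ := (Ext.mk₀_bijective _ _).2 x
        have : f = 0 := ModuleCat.hom_ext
          (linearMap_eq_zero_of_isInjectiveHull hj hC.linearMap_eq_zero f.hom)
        rw [this, Ext.mk₀_zero]
      | succ n => exact Ext.eq_zero_of_injective x
    have hk : ExtVanishes R (ResidueField R) (I ⧸ LinearMap.range j) := by
      intro n x
      obtain ⟨y, rfl⟩ := Ext.covariant_sequence_exact₃ _ hS x rfl (hC _ _)
      rw [hkI n y, Ext.zero_comp]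
    obtain ⟨x, rfl⟩ := Ext.covariant_sequence_exact₁ _ hS e (Ext.eq_zero_of_injective _) rfl
    rw [ih hk x, Ext.zero_comp]

end ExtVanishing

/-! ### Ext from the residue field into the cokernel of evaluation. -/

section BidualCokernel

variable {R : Type u} [CommRing R] {S : Type u} [CommRing S] [Algebra R S]
variable {E : Type u} [AddCommGroup E] [Module R E] [Module S E] [IsScalarTower R S E]

lemma subsingleton_bidualCoker {M : Type u} [AddCommGroup M] [Module R M]
    (h : Function.Surjective (bidualMap R S E M)) : Subsingleton (BidualCoker R S E M) := by
  rw [Submodule.Quotient.subsingleton_iff]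
  exact LinearMap.range_eq_top.2 h

variable [IsLocalRing R] {ι : ResidueField R →ₗ[R] E}

theorem IsInjectiveHull.extVanishes_bidualCoker_of_isNoetherian [IsNoetherianRing R]
    (hι : IsInjectiveHull ι) [Module.Injective S E]
    (M : Type u) [AddCommGroup M] [Module R M] [IsNoetherian R M] :
    ExtVanishes R (ResidueField R) (BidualCoker R S E M) := by
  refine noetherian_quotient_induction
    (P := fun M [AddCommGroup M] [Module R M] =>
      ExtVanishes R (ResidueField R) (BidualCoker R S E M)) ?_ M
  intro Q _ _ _ ih
  rcases subsingleton_or_nontrivial Q with hQ0 | hQ0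
  · have := subsingleton_bidualCoker (bidualMap_surjective_of_subsingleton (R := R) S E Q)
    exact .of_subsingleton _ _
  by_cases hk : Subsingleton (ResidueField R →ₗ[R] Q)
  -- As `Q` is noetherian without a copy of `k`, some element annihilating `k` is regular on `Q`.
  · obtain ⟨x, hx, hreg⟩ := (IsSMulRegular.subsingleton_linearMap_iff (R := R)).1 hk
    let f : Q →ₗ[R] Q := x • LinearMap.id
    have hf : Function.Injective f := hreg
    have hrange : LinearMap.range f ≠ ⊥ := fun h => by
      obtain ⟨y, hy⟩ := exists_ne (0 : Q)
      refine hy (hf ?_)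
      rw [map_zero]
      exact (Submodule.eq_bot_iff _).1 h _ ⟨y, rfl⟩
    obtain ⟨h1, h2, h3⟩ := hι.bidualCoker_shortExact R S f (LinearMap.range f).mkQ hf
      (Submodule.mkQ_surjective _) (LinearMap.exact_iff.2 (Submodule.ker_mkQ _))
    exact .of_smul_injective x (Module.mem_annihilator.1 hx) (bidualCokerMap_smul R S E x)
      h1 h3 h2 (ih _ hrange)
  -- Otherwise `k` embeds in `Q`. Its cokernel of evaluation is zero, so only the quotient by `k`
  -- contributes.
  · obtain ⟨φ, hφ⟩ : ∃ φ : ResidueField R →ₗ[R] Q, φ ≠ 0 := by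
      by_contra! h
      exact hk ⟨fun a b => by rw [h a, h b]⟩
    have hinj : Function.Injective φ := by
      rw [← LinearMap.ker_eq_bot, Submodule.eq_bot_iff]
      intro z hz
      by_contra hz0
      refine hφ (LinearMap.ext fun w => ?_)
      obtain ⟨r, hr⟩ := residueField_smul_surjective (w * z⁻¹)
      have : w = r • z := by
        rw [Algebra.smul_def, ← mul_one (algebraMap _ _ r), ← Algebra.smul_def, hr,
          inv_mul_cancel_right₀ hz0]
      rw [this, map_smul, LinearMap.mem_ker.1 hz, smul_zero, LinearMap.zero_apply]
    obtain ⟨h1, h2, h3⟩ := hι.bidualCoker_shortExact R S φ (LinearMap.range φ).mkQ hinj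
      (Submodule.mkQ_surjective _) (LinearMap.exact_iff.2 (Submodule.ker_mkQ _))
    have := subsingleton_bidualCoker (bidualMap_residueField_surjective S hι)
    exact .of_exact h1 h3 h2 (.of_subsingleton _ _)
      (ih _ fun h => hφ (LinearMap.range_eq_bot.1 h))

theorem IsInjectiveHull.extVanishes_bidualCoker_of_isMiniMax [IsNoetherianRing R]
    (hι : IsInjectiveHull ι) [Module.Injective S E]
    (hsurj : ∀ g : E →ₗ[R] E, ∃ s : S, ∀ x, g x = s • x)
    (M : Type u) [AddCommGroup M] [Module R M] (hM : IsMiniMax R M) :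
    ExtVanishes R (ResidueField R) (BidualCoker R S E M) := by
  obtain ⟨N, _, _⟩ := hM
  obtain ⟨h1, h2, h3⟩ := hι.bidualCoker_shortExact R S N.subtype N.mkQ N.injective_subtype
    N.mkQ_surjective (LinearMap.exact_subtype_mkQ N)
  have := subsingleton_bidualCoker
    (hι.bidualMap_surjective_of_isArtinian (S := S) hsurj (M ⧸ N))
  exact .of_exact h1 h3 h2 (hι.extVanishes_bidualCoker_of_isNoetherian N) (.of_subsingleton _ _)

end BidualCokernel

/-- Carries an isomorphism across a dimension shift. Only the kernels of the connecting maps have to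
correspond, so their signs and naturality need no comparison. -/
lemma exists_addEquiv_of_surjective {U V U' V' : Type*} [AddCommGroup U] [AddCommGroup V]
    [AddCommGroup U'] [AddCommGroup V'] (p : U →+ V) (p' : U' →+ V')
    (hp : Function.Surjective p) (hp' : Function.Surjective p') (e : U ≃+ U')
    (h : ∀ u, p u = 0 ↔ p' (e u) = 0) : ∃ e' : V ≃+ V', ∀ u, e' (p u) = p' (e u) := by
  let f : V →+ V' := p.liftOfSurjective hp ⟨p'.comp e.toAddMonoidHom, fun u hu => (h u).1 hu⟩
  have hf : ∀ u, f (p u) = p' (e u) := fun u =>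
    AddMonoidHom.liftOfRightInverse_comp_apply p _ _ ⟨p'.comp e.toAddMonoidHom, _⟩ u
  refine ⟨AddEquiv.ofBijective f ⟨?_, fun y => ?_⟩, hf⟩
  · rw [injective_iff_map_eq_zero]
    intro v hv
    obtain ⟨u, rfl⟩ := hp v
    exact (h u).2 ((hf u).symm.trans hv)
  · obtain ⟨u', rfl⟩ := hp' y
    exact ⟨p (e.symm u'), by rw [hf, e.apply_symm_apply]⟩

open Abelian in
lemma postcomp_extClass_comp_eq_zero {C : Type*} [Category* C] [Abelian C] [HasExt.{u} C]
    {T : ShortComplex C} (hT : T.ShortExact) {X : C} {n m : ℕ} (h : n + 1 = m)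
    (y : Ext X T.X₂ n) :
    hT.extClass.postcomp X h (y.comp (Ext.mk₀ T.g) (add_zero n)) = 0 :=
  (Ext.comp_assoc_of_second_deg_zero _ _ _ h).trans (by rw [hT.comp_extClass, Ext.comp_zero])

/-! ### Balancing Ext over the two rings. -/

section Swap

variable {R : Type u} [CommRing R] {S : Type u} [CommRing S] [Algebra R S]
variable {E : Type u} [AddCommGroup E] [Module R E] [Module S E] [IsScalarTower R S E]

variable (R E) in
/-- Precomposition on `S`-linear maps into `E`, as an `R`-linear map. -/
def dualPrecomp {X Y : Type u} [AddCommGroup X] [Module S X] [AddCommGroup Y] [Module S Y]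
    (f : X →ₗ[S] Y) : (Y →ₗ[S] E) →ₗ[R] (X →ₗ[S] E) where
  toFun φ := φ.comp f
  map_add' _ _ := rfl
  map_smul' _ _ := rfl

/-- Interchange of the arguments of a bilinear map. -/
def homSwap (A X : Type u) [AddCommGroup A] [Module R A] [AddCommGroup X] [Module S X] :
    (A →ₗ[R] (X →ₗ[S] E)) ≃+ (X →ₗ[S] (A →ₗ[R] E)) where
  toFun f :=
    { toFun x :=
        { toFun a := f a x
          map_add' a b := by rw [map_add, LinearMap.add_apply]
          map_smul' r a := by rw [map_smul, LinearMap.smul_apply]; rfl }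
      map_add' x y := by ext a; exact map_add (f a) x y
      map_smul' s x := by ext a; exact map_smul (f a) s x }
  invFun g :=
    { toFun a :=
        { toFun x := g x a
          map_add' x y := by rw [map_add, LinearMap.add_apply]
          map_smul' s x := by rw [map_smul, LinearMap.smul_apply]; rfl }
      map_add' a b := by ext x; exact map_add (g x) a b
      map_smul' r a := by ext x; exact map_smul (g x) r a }
  left_inv _ := rfl
  right_inv _ := rfl
  map_add' _ _ := rfl

/-- The dual of a free module is a product of copies of `E`. -/
lemma injective_finsupp_dual [hR : Module.Injective R E] (X : Type u) :
    Module.Injective R ((X →₀ S) →ₗ[S] E) :=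
  (Module.Baer.of_equiv (Finsupp.llift E S R X) (Module.Baer.of_injective
    (Module.Injective.pi R fun _ : X => E))).injective

open Abelian

/-- Balancing of the derived functors of `(A, X) ↦ Hom_R(A, Hom_S(X, E)) = Hom_S(X, Hom_R(A, E))`,
compatibly with an action of `S` on `A` through which all maps from `A` to `E` are `S`-linear. -/
theorem exists_ext_swap [Module.Injective R E] [hS : Module.Injective S E]
    {A : Type u} [AddCommGroup A] [Module R A] (σ : S → (A →ₗ[R] A))
    (hσ : ∀ (f : A →ₗ[R] E) (s : S) (a : A), f (σ s a) = s • f a) (i : ℕ)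
    (X : Type u) [AddCommGroup X] [Module S X] :
    ∃ e : Ext (ModuleCat.of R A) (ModuleCat.of R (X →ₗ[S] E)) i ≃+
        Ext (ModuleCat.of S X) (ModuleCat.of S (A →ₗ[R] E)) i,
      ∀ (s : S) x, e ((Ext.mk₀ (ModuleCat.ofHom (σ s))).comp x (zero_add i)) = s • e x := by
  let e₀ (X : Type u) [AddCommGroup X] [Module S X] :
      Ext (ModuleCat.of R A) (ModuleCat.of R (X →ₗ[S] E)) 0 ≃+
        Ext (ModuleCat.of S X) (ModuleCat.of S (A →ₗ[R] E)) 0 :=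
    Ext.addEquiv₀.trans (AddEquiv.trans
      { toFun f := ModuleCat.ofHom (homSwap A X f.hom)
        invFun g := ModuleCat.ofHom ((homSwap A X).symm g.hom)
        left_inv _ := rfl
        right_inv _ := rfl
        map_add' _ _ := rfl } Ext.addEquiv₀.symm)
  have he₀ (X : Type u) [AddCommGroup X] [Module S X] (f : A →ₗ[R] (X →ₗ[S] E)) :
      e₀ X (Ext.mk₀ (ModuleCat.ofHom f)) = Ext.mk₀ (ModuleCat.ofHom (homSwap A X f)) := by
    change Ext.addEquiv₀.symm (ModuleCat.ofHom (homSwap A X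
      (Ext.addEquiv₀ (Ext.addEquiv₀.symm (ModuleCat.ofHom f))).hom)) = _
    rw [AddEquiv.apply_symm_apply]
    rfl
  have hsurj₀ (X : Type u) [AddCommGroup X] [Module S X]
      (x : Ext (ModuleCat.of R A) (ModuleCat.of R (X →ₗ[S] E)) 0) :
      ∃ f : A →ₗ[R] (X →ₗ[S] E), Ext.mk₀ (ModuleCat.ofHom f) = x := by
    obtain ⟨f, rfl⟩ := (Ext.mk₀_bijective _ _).2 x
    exact ⟨f.hom, rfl⟩
  have hlin₀ (X : Type u) [AddCommGroup X] [Module S X] (s : S)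
      (x : Ext (ModuleCat.of R A) (ModuleCat.of R (X →ₗ[S] E)) 0) :
      e₀ X ((Ext.mk₀ (ModuleCat.ofHom (σ s))).comp x (zero_add 0)) = s • e₀ X x := by
    obtain ⟨f, rfl⟩ := hsurj₀ X x
    rw [Ext.mk₀_comp_mk₀, ← ModuleCat.ofHom_comp, he₀, he₀, ← Ext.mk₀_smul]
    congr 1
    ext x a
    exact hσ ((homSwap A X f) x) s a
  induction i generalizing X with
  | zero => exact ⟨e₀ X, hlin₀ X⟩
  | succ i ih =>
    -- The free cover of `X` shifts degrees on both sides: it is projective over `S`, and its dual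
    -- is injective over `R`. Injectivity of `E` over `S` keeps the dual sequence exact.
    let π : (X →₀ S) →ₗ[S] X := Finsupp.linearCombination S id
    have hπ : Function.Surjective π := fun x => ⟨Finsupp.single x 1, by simp [π]⟩
    let K : Submodule S (X →₀ S) := LinearMap.ker π
    have hSS := LinearMap.shortExact_shortComplexKer hπ
    have hinj : Function.Injective (dualPrecomp R E π) := fun φ ψ h => by
      ext x
      obtain ⟨p, rfl⟩ := hπ x
      exact LinearMap.congr_fun h p
    have hsurj : Function.Surjective (dualPrecomp R E (X := K) K.subtype) := fun φ => by
      obtain ⟨ψ, hψ⟩ := hS.out (X := K) (Y := X →₀ S) K.subtype K.injective_subtype φ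
      exact ⟨ψ, LinearMap.ext hψ⟩
    have hexact : Function.Exact (dualPrecomp R E π) (dualPrecomp R E (X := K) K.subtype) := by
      intro φ
      constructor
      · intro hφ
        have hle : LinearMap.ker π ≤ LinearMap.ker φ := fun p hp =>
          LinearMap.congr_fun hφ ⟨p, hp⟩
        obtain ⟨ψ, hψ⟩ := hS.out ((LinearMap.ker π).liftQ π le_rfl)
          (LinearMap.ker_eq_bot.1 (Submodule.ker_liftQ_eq_bot _ _ _ le_rfl))
          ((LinearMap.ker π).liftQ φ hle)
        exact ⟨ψ, LinearMap.ext fun p => hψ (Submodule.Quotient.mk p)⟩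
      · rintro ⟨ψ, rfl⟩
        ext p
        exact (congrArg ψ p.2).trans (map_zero ψ)
    have hSR := shortExact_of_exact hinj hsurj hexact
    have : Injective (ModuleCat.of R ((X →₀ S) →ₗ[S] E)) :=
      haveI := injective_finsupp_dual (R := R) (S := S) (E := E) X
      Module.injective_object_of_injective_module R _
    have : Projective (ModuleCat.of S (X →₀ S)) :=
      ModuleCat.projective_of_free (Finsupp.basisSingleOne)
    let p := hSR.extClass.postcomp (ModuleCat.of R A) (rfl : i + 1 = i + 1)
    let p' := hSS.extClass.precomp (ModuleCat.of S (A →ₗ[R] E)) (add_comm 1 i)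
    have hp : Function.Surjective p := fun x =>
      Ext.covariant_sequence_exact₁ _ hSR x (Ext.eq_zero_of_injective _) rfl
    have hp' : Function.Surjective p' := fun x =>
      Ext.contravariant_sequence_exact₃ hSS _ x (Ext.eq_zero_of_projective _) (add_comm 1 i)
    obtain ⟨e, he, hker⟩ : ∃ e : Ext (ModuleCat.of R A) (ModuleCat.of R (K →ₗ[S] E)) i ≃+
        Ext (ModuleCat.of S K) (ModuleCat.of S (A →ₗ[R] E)) i,
        (∀ (s : S) x, e ((Ext.mk₀ (ModuleCat.ofHom (σ s))).comp x (zero_add i)) = s • e x) ∧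
        ∀ x, p x = 0 ↔ p' (e x) = 0 := by
      cases i with
      | zero =>
        -- In degree zero both kernels are the maps that come from the free cover, and these match
        -- by naturality of the swap. In higher degrees both connecting maps are injective.
        have hcomp (f : A →ₗ[R] ((X →₀ S) →ₗ[S] E)) : e₀ K ((Ext.mk₀ (ModuleCat.ofHom f)).comp
            (Ext.mk₀ (ModuleCat.ofHom (dualPrecomp R E (X := K) K.subtype))) (add_zero 0)) =
            (Ext.mk₀ (ModuleCat.ofHom K.subtype)).comp
              (Ext.mk₀ (ModuleCat.ofHom (homSwap A _ f))) (zero_add 0) := by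
          rw [Ext.mk₀_comp_mk₀, ← ModuleCat.ofHom_comp, Ext.mk₀_comp_mk₀]
          exact he₀ K _
        refine ⟨e₀ K, hlin₀ K, fun x => ⟨fun hx => ?_, fun hx => ?_⟩⟩
        · obtain ⟨y, rfl⟩ := Ext.covariant_sequence_exact₃ _ hSR x rfl hx
          obtain ⟨f, rfl⟩ := hsurj₀ _ y
          exact (congrArg p' (hcomp f)).trans (hSS.extClass_comp_assoc (h := add_comm 1 0) _)
        · obtain ⟨y, hy⟩ := Ext.contravariant_sequence_exact₁ hSS _ _ (add_comm 1 _) hx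
          obtain ⟨g, rfl⟩ := (Ext.mk₀_bijective _ _).2 y
          have hx : x = (Ext.mk₀ (ModuleCat.ofHom ((homSwap A _).symm g.hom))).comp
              (Ext.mk₀ (ModuleCat.ofHom (dualPrecomp R E (X := K) K.subtype))) (add_zero 0) :=
            (e₀ K).injective (by rw [hcomp, ← hy, AddEquiv.apply_symm_apply]; rfl)
          rw [hx]
          exact postcomp_extClass_comp_eq_zero hSR _ _
      | succ i =>
        obtain ⟨e, he⟩ := ih K
        refine ⟨e, he, fun x => ?_⟩
        have h1 : p x = 0 ↔ x = 0 := by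
          refine ⟨fun hx => ?_, fun hx => by rw [hx, map_zero]⟩
          obtain ⟨y, rfl⟩ := Ext.covariant_sequence_exact₃ _ hSR x rfl hx
          rw [Ext.eq_zero_of_injective y, Ext.zero_comp]
        have h2 : p' (e x) = 0 ↔ e x = 0 := by
          refine ⟨fun hx => ?_, fun hx => by rw [hx, map_zero]⟩
          obtain ⟨y, hy⟩ := Ext.contravariant_sequence_exact₁ hSS _ _ (add_comm 1 _) hx
          rw [← hy, Ext.eq_zero_of_projective y, Ext.comp_zero]
        rw [h1, h2, EmbeddingLike.map_eq_zero_iff]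
    obtain ⟨e', he'⟩ := exists_addEquiv_of_surjective p p' hp hp' e hker
    refine ⟨e', fun s x => ?_⟩
    obtain ⟨x, rfl⟩ := hp x
    have h1 : (Ext.mk₀ (ModuleCat.ofHom (σ s))).comp (p x) (zero_add (i + 1)) =
        p ((Ext.mk₀ (ModuleCat.ofHom (σ s))).comp x (zero_add i)) :=
      (Ext.comp_assoc _ _ _ (zero_add i) rfl (by lia)).symm
    rw [h1, he', he', he]
    exact Ext.comp_smul _ _ (add_comm 1 i) _

end Swap

/-! ### Specialization to the completion and the main theorem. -/

open Abelian

variable {R : Type u} [CommRing R] [IsLocalRing R]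

/-- The module structure over the completion on a torsion module. -/
@[reducible]
noncomputable def completionModule {L : Type*} [AddCommGroup L] [Module R L]
    (h : IsMaxTorsion R L) : Module (AdicCompletion (maximalIdeal R) R) L :=
  Module.compHom L (completionAction h)

lemma completionModule_isScalarTower {L : Type*} [AddCommGroup L] [Module R L]
    (h : IsMaxTorsion R L) :
    letI := completionModule h
    IsScalarTower R (AdicCompletion (maximalIdeal R) R) L := by
  let := completionModule h
  refine ⟨fun a s x => ?_⟩
  change completionAction h (a • s) x = a • completionAction h s x
  rw [Algebra.smul_def, map_mul]
  exact completionAction_algebraMap h a _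

variable [IsNoetherianRing R] {E : Type u} [AddCommGroup E] [Module R E]
  {ι : ResidueField R →ₗ[R] E}

lemma IsInjectiveHull.exists_completion_smul_eq (hι : IsInjectiveHull ι) :
    letI := completionModule hι.isMaxTorsion
    ∀ g : E →ₗ[R] E, ∃ s : AdicCompletion (maximalIdeal R) R, ∀ x, g x = s • x := by
  intro g
  obtain ⟨s, rfl⟩ := hι.completionAction_surjective g
  exact ⟨s, fun _ => rfl⟩

/-- The injective hull of the residue field is injective over the completion. -/
theorem IsInjectiveHull.injective_completion (hι : IsInjectiveHull ι) :
    letI := completionModule hι.isMaxTorsion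
    Module.Injective (AdicCompletion (maximalIdeal R) R) E := by
  let := completionModule hι.isMaxTorsion
  have := completionModule_isScalarTower hι.isMaxTorsion
  have := hι.isArtinian
  have := hι.injective_module
  have hinj : ∀ s : AdicCompletion (maximalIdeal R) R, (∀ x : E, s • x = 0) → s = 0 :=
    fun s hs => hι.completionAction_injective
      ((LinearMap.ext hs : completionAction hι.isMaxTorsion s = 0).trans (map_zero _).symm)
  have := isNoetherianRing_of_isArtinian hι.exists_completion_smul_eq hinj
  exact hι.injective_of_isNoetherianRing hι.exists_completion_smul_eq hinj

/-- The Matlis dual of an artinian module is noetherian over the completion. -/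
theorem IsInjectiveHull.isNoetherian_matlisDual (hι : IsInjectiveHull ι) (A : Type u)
    [AddCommGroup A] [Module R A] [IsArtinian R A] :
    IsNoetherian (AdicCompletion (maximalIdeal R) R) (matlisDual hι.isMaxTorsion A) := by
  let := completionModule hι.isMaxTorsion
  have := completionModule_isScalarTower hι.isMaxTorsion
  have := hι.injective_module
  exact isNoetherian_dual hι.exists_completion_smul_eq A

/-- `Ext^i(A, M) ≅ Ext^i(M^∨, A^∨)` for `A` torsion and `M` mini-max. -/
theorem IsInjectiveHull.nonempty_ext_equiv (hι : IsInjectiveHull ι) {A : Type u}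
    [AddCommGroup A] [Module R A] (hA : IsMaxTorsion R A) (M : Type u) [AddCommGroup M]
    [Module R M] (hM : IsMiniMax R M) (i : ℕ) :
    letI := extCompletionModule hA M i
    Nonempty (Ext (ModuleCat.of R A) (ModuleCat.of R M) i ≃ₗ[AdicCompletion (maximalIdeal R) R]
      Ext (matlisDual hι.isMaxTorsion M) (matlisDual hι.isMaxTorsion A) i) := by
  let := completionModule hι.isMaxTorsion
  have := completionModule_isScalarTower hι.isMaxTorsion
  have := hι.injective_module
  have := hι.injective_completion
  let S := AdicCompletion (maximalIdeal R) R
  let β := bidualMap R S E M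
  -- With this vanishing, the long exact sequence makes `Ext^i(A, M)` isomorphic to `Ext^i(A, -)` of
  -- the bidual, to which the swap applies.
  have hC : ExtVanishes R A (BidualCoker R S E M) := .of_isMaxTorsion hA
    (hι.extVanishes_bidualCoker_of_isMiniMax hι.exists_completion_smul_eq M hM)
  have hβ := shortExact_of_exact (bidualMap_injective S hι)
    (LinearMap.range β).mkQ_surjective (LinearMap.exact_iff.2 (Submodule.ker_mkQ _))
  let p := (Ext.mk₀ (ModuleCat.ofHom β)).postcomp (ModuleCat.of R A) (add_zero i)
  have hp : Function.Bijective p := by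
    refine ⟨?_, fun x => Ext.covariant_sequence_exact₂ _ hβ x (hC i _)⟩
    rw [injective_iff_map_eq_zero]
    intro x hx
    cases i with
    | zero =>
      have : Mono (ModuleCat.ofHom β) :=
        (ModuleCat.mono_iff_injective _).2 (bidualMap_injective S hι)
      exact Ext.postcomp_mk₀_injective_of_mono (ModuleCat.of R A) (ModuleCat.ofHom β)
        (hx.trans (map_zero _).symm)
    | succ i =>
      obtain ⟨y, rfl⟩ := Ext.covariant_sequence_exact₁ _ hβ x hx rfl
      rw [hC i y, Ext.zero_comp]
  obtain ⟨e, he⟩ := exists_ext_swap (completionAction hA)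
    (fun f s a => map_completionAction hA hι.isMaxTorsion f s a) i (M →ₗ[R] E)
  let := extCompletionModule hA M i
  refine ⟨{ (AddEquiv.ofBijective p hp).trans e with map_smul' := fun s x => ?_ }⟩
  change e (((Ext.mk₀ (ModuleCat.ofHom (completionAction hA s))).comp x (zero_add i)).comp
    (Ext.mk₀ (ModuleCat.ofHom β)) (add_zero i)) =
      s • e (x.comp (Ext.mk₀ (ModuleCat.ofHom β)) (add_zero i))
  rw [← he, Ext.comp_assoc_of_third_deg_zero]

end MatlisDuality

theorem mainTheorem3 {R : Type u} [CommRing R] [IsNoetherianRing R] [IsLocalRing R]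
    {E : Type u} [AddCommGroup E] [Module R E]
    (ι : ResidueField R →ₗ[R] E) (hι : MatlisDuality.IsInjectiveHull ι)
    (A : Type u) [AddCommGroup A] [Module R A] [IsArtinian R A] :
    (∀ (M : Type u) [AddCommGroup M] [Module R M], MatlisDuality.IsMiniMax R M → ∀ i : ℕ,
      letI := MatlisDuality.extCompletionModule
        (MatlisDuality.isMaxTorsion_of_isArtinian (R := R) (L := A)) M i
      Nonempty (Abelian.Ext (ModuleCat.of R A) (ModuleCat.of R M) i
        ≃ₗ[AdicCompletion (maximalIdeal R) R]
          Abelian.Ext (MatlisDuality.matlisDual hι.isMaxTorsion M)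
            (MatlisDuality.matlisDual hι.isMaxTorsion A) i)) ∧
    (∀ (A' : Type u) [AddCommGroup A'] [Module R A'] [IsArtinian R A'],
      IsNoetherian (AdicCompletion (maximalIdeal R) R)
        (MatlisDuality.matlisDual hι.isMaxTorsion A) ∧
      IsNoetherian (AdicCompletion (maximalIdeal R) R)
        (MatlisDuality.matlisDual hι.isMaxTorsion A') ∧
      ∀ i : ℕ,
        letI := MatlisDuality.extCompletionModule
          (MatlisDuality.isMaxTorsion_of_isArtinian (R := R) (L := A)) A' i
        Nonempty (Abelian.Ext (ModuleCat.of R A) (ModuleCat.of R A') i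
          ≃ₗ[AdicCompletion (maximalIdeal R) R]
            Abelian.Ext (MatlisDuality.matlisDual hι.isMaxTorsion A')
              (MatlisDuality.matlisDual hι.isMaxTorsion A) i)) := by
  refine ⟨fun M _ _ hM i => hι.nonempty_ext_equiv _ M hM i, fun A' _ _ _ =>
    ⟨hι.isNoetherian_matlisDual A, hι.isNoetherian_matlisDual A', fun i =>
      -- An artinian module is mini-max with zero noetherian part.
      hι.nonempty_ext_equiv _ A' ⟨⊥, inferInstance, inferInstance⟩ i⟩⟩
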